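/- **Setting.** Let $N\ge 1$, $M\in\mathbb N$. For $1\le i\le N$ let $\mathcal X_i$ be a set, for $1\le j\le M$ let $\mathcal E_j$ be a separable real Hilbert space, let $g_{ij}\colon\mathcal X_i\to\mathcal E_j$ and $f_j\colon\mathcal E_j\to\mathbb R$ be maps. Put $\mathcal X=\prod_i\mathcal X_i$, $\mathcal E=\prod_j\mathcal E_j$ (Hilbert product), $g_i=(g_{ij})_j$, $f(y)=\sum_j f_j(y_j)$, $G(x)=\frac1N\sum_i g_i(x_i)$ and $J(x)=f(G(x))$ for $x\in\mathcal X$. For a finitely supported probability distribution $\mu_i$ on $\mathcal X_i$ let $E_{\mu_i}[g_i]$ be the mean of $g_i$, and let $$\mathcal J^*=\inf_{\mu_1,\dots,\mu_N} f\Big(\frac1N\sum_{i=1}^N E_{\mu_i}[g_i]\Big),$$ the infimum being over all finitely supported probability distributions $\mu_i$ on $\mathcal X_i$. Let $S_{ij}=g_{ij}(\mathcal X_i)$, $S_j=\frac1N\sum_i S_{ij}$ (Minkowski sum). Assume: 1. each $S_{ij}$ has finite diameter $d_{ij}$; $f_j$ is $L_j$-Lipschitz on $\mathrm{conv}(S_j)$;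 $f_j$ is continuously differentiable on a neighbourhood of $\mathrm{conv}(S_j)$ and $\nabla f_j$ is $\tilde L_j$-Lipschitz on $\mathrm{conv}(S_j)$; 2. each $f_j$ is lower semicontinuous and convex on $\mathcal E_j$; 3. for each $i$ we are given a map $\mathbb S_i\colon\mathrm{conv}(G(\mathcal X))\to\mathcal X_i$ such that $\mathbb S_i(y)$ minimizes $x_i\mapsto\langle\nabla f(y),g_i(x_i)\rangle$ over $\mathcal X_i$ for every $y\in\mathrm{conv}(G(\mathcal X))$. Put $C_0=\sum_j L_j\max_i d_{ij}$ and $C_1=\frac1N\sum_j\tilde L_j\sum_i d_{ij}^2$. **Algorithm (stochastic Frank–Wolfe).** Fix integers $n_k\ge1$ ($k\in\mathbb N$), stepsizes $\omega_k=\frac2{k+2}$ and $x^0\in\mathcal X$. For $k=0,1,2,\dots$: let $y^k=G(x^k)$ and $\bar x^k_i=\mathbb S_i(y^k)$; for $1\le j\le n_k$, $1\le i\le N$ draw $\lambda^{k,j}_i\sim\mathrm{Bern}(\omega_k)$, independently of each other and of all previously defined random variables, and put $\hat x^{k,j}_i=\bar x^k_i$ if $\lambda^{k,j}_i=1$ and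 $\hat x^{k,j}_i=x^k_i$ if $\lambda^{k,j}_i=0$; let $x^{k+1}$ be an element of $\{\hat x^{k,1},\dots,\hat x^{k,n_k}\}$ with the smallest value of $J$. **Theorem.** Let $\gamma_K=J(x^K)-\mathcal J^*$. For every $K=1,\dots,2N$, the random variable $\gamma_K$ is square integrable and $$\mathbb E[\gamma_K]\le\frac{4C_1}{K}.$$ Moreover, for all $\epsilon>0$, $$\mathbb P\Big[\gamma_K<\frac{4C_1}{K}+\epsilon\Big]\ \ge\ 1-\exp\Big(\frac{-\epsilon^2N}{2(v_K+\epsilon m_K/3)}\Big),$$ where $$v_K=\frac{2C_0^2}{K^2(K+1)^2}\sum_{k=1}^{K-1}\frac{k(k+1)^2}{n_k},\qquad m_K=\frac{C_0}{K(K+1)}\max_{k=1,\dots,K-1}\frac{(k+1)(k+2)}{n_k}$$ (with the conventions that the maximum over the empty set is $0$, and that the exponential is $\exp(-\infty)=0$ if $v_K+\epsilon m_K/3=0$). Finally, $$\mathrm{Var}[\gamma_K]\le\frac{16C_1^2}{K^2}+\frac{v_K}{N}\qquad\text{and}\qquad\mathbb E\Big[\max\Big(\gamma_K-\frac{4C_1}{K},0\Big)^2\Big]\le\frac{v_K}{N}.$$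 -/

import Mathlib

open MeasureTheory ProbabilityTheory
open scoped NNReal ENNReal Pointwise Gradient InnerProductSpace

universe u v w

noncomputable section

/-- The finitely supported probability distributions on `Ω`: the convex hull of the Dirac masses,
inside the space of finitely supported weights on `Ω`. -/
def finDistr (Ω : Type u) : Set (Ω →₀ ℝ) :=
  convexHull ℝ (Set.range fun x : Ω => Finsupp.single x (1 : ℝ))

/-- The mean `∑ w_l F(x_l)` of `F` under the finitely supported distribution `∑ w_l δ_{x_l}`. -/
def finMean {Ω : Type u} {H : Type v} [AddCommGroup H] [Module ℝ H]
    (μ : Ω →₀ ℝ) (F : Ω → H) : H :=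
  μ.sum fun x w => w • F x

/-- Data of the aggregative problem with `N` agents and `M` aggregates: agent `i` chooses a point
of the set `X i`, contributes `g i j` to the `j`-th aggregate, whose cost is `f j`. -/
structure AggProblem (N M : ℕ) (X : Fin N → Type u) (E : Fin M → Type v) where
  g : (i : Fin N) → (j : Fin M) → X i → E j
  f : (j : Fin M) → E j → ℝ

namespace AggProblem

variable {N M : ℕ} {X : Fin N → Type u} {E : Fin M → Type v}
  [∀ j, NormedAddCommGroup (E j)] [∀ j, InnerProductSpace ℝ (E j)]

/-- The contribution mapping `g_i = (g_ij)_j` into the Hilbert product of the spaces `E j`. -/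
def gVec (P : AggProblem N M X E) (i : Fin N) (x : X i) : PiLp 2 E :=
  WithLp.toLp 2 fun j => P.g i j x

/-- The total cost `f(y) = ∑_j f_j(y_j)`. -/
def fTot (P : AggProblem N M X E) (y : PiLp 2 E) : ℝ := ∑ j, P.f j (y j)

/-- The aggregate `G(x) = (1/N) ∑_i g_i(x_i)`. -/
def agg (P : AggProblem N M X E) (x : ∀ i, X i) : PiLp 2 E :=
  (N : ℝ)⁻¹ • ∑ i, P.gVec i (x i)

/-- The criterion `J(x) = f(G(x))`. -/
def cost (P : AggProblem N M X E) (x : ∀ i, X i) : ℝ := P.fTot (P.agg x)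

/-- The relaxed criterion `f((1/N) ∑_i E_{μ_i}[g_i])`. -/
def relaxedCost (P : AggProblem N M X E) (μ : ∀ i, X i →₀ ℝ) : ℝ :=
  P.fTot ((N : ℝ)⁻¹ • ∑ i, finMean (μ i) (P.gVec i))

/-- The value of the relaxed problem: the infimum of the relaxed criterion over all `N`-tuples of
finitely supported probability distributions. -/
def relaxedValue (P : AggProblem N M X E) : ℝ :=
  sInf (P.relaxedCost '' {μ | ∀ i, μ i ∈ finDistr (X i)})

/-- The diameter `d_ij` of the range of `g_ij`. -/
def diam (P : AggProblem N M X E) (i : Fin N) (j : Fin M) : ℝ :=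
  Metric.diam (Set.range (P.g i j))

/-- The set `S_j = (1/N) ∑_i S_ij` (Minkowski sum), where `S_ij` is the range of `g_ij`. -/
def aggRange (P : AggProblem N M X E) (j : Fin M) : Set (E j) :=
  (N : ℝ)⁻¹ • ∑ i, Set.range (P.g i j)

/-- Bounded ranges, and `f_j` Lipschitz and continuously differentiable with Lipschitz gradient,
with moduli `L j` and `Lt j`. -/
structure Regular [∀ j, CompleteSpace (E j)] (P : AggProblem N M X E) (L Lt : Fin M → ℝ≥0) :
    Prop where
  bounded : ∀ i j, Bornology.IsBounded (Set.range (P.g i j))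
  lipschitz : ∀ j, LipschitzOnWith (L j) (P.f j) (convexHull ℝ (P.aggRange j))
  contDiff : ∀ j, ∃ U : Set (E j), IsOpen U ∧ convexHull ℝ (P.aggRange j) ⊆ U ∧
    ContDiffOn ℝ 1 (P.f j) U
  lipschitz_gradient : ∀ j, LipschitzOnWith (Lt j) (∇ (P.f j)) (convexHull ℝ (P.aggRange j))

/-- Each `f_j` is lower semicontinuous and convex on the whole space. -/
structure ConvexCost (P : AggProblem N M X E) : Prop where
  lsc : ∀ j, LowerSemicontinuous (P.f j)
  convex : ∀ j, ConvexOn ℝ Set.univ (P.f j)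

/-- `S i y` solves the `i`-th linearized subproblem `inf ⟨∇f(y), g_i(·)⟩` for every `y` in the
convex hull of the range of `G`; the values of `S i` at other points play no role. -/
def IsBestResponse [∀ j, CompleteSpace (E j)] (P : AggProblem N M X E)
    (S : (i : Fin N) → PiLp 2 E → X i) : Prop :=
  ∀ i, ∀ y ∈ convexHull ℝ (Set.range P.agg), ∀ x' : X i,
    ⟪∇ P.fTot y, P.gVec i (S i y)⟫_ℝ ≤ ⟪∇ P.fTot y, P.gVec i x'⟫_ℝ

/-- The constant `C₀ = ∑_j L_j max_i d_ij`. -/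
def C₀ (P : AggProblem N M X E) (L : Fin M → ℝ≥0) : ℝ :=
  ∑ j, (L j : ℝ) * ⨆ i, P.diam i j

/-- The constant `C₁ = (1/N) ∑_j Lt_j ∑_i d_ij²`. -/
def C₁ (P : AggProblem N M X E) (Lt : Fin M → ℝ≥0) : ℝ :=
  (N : ℝ)⁻¹ * ∑ j, (Lt j : ℝ) * ∑ i, P.diam i j ^ 2

/-- The candidate drawn from the current point `x`: agent `i` moves to its best response at the
current aggregate if the Bernoulli outcome `b i` is `true` (one), and stays if it is `false`
(zero). -/
def candidate (P : AggProblem N M X E) (S : (i : Fin N) → PiLp 2 E → X i)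
    (x : ∀ i, X i) (b : Fin N → Bool) : ∀ i, X i :=
  fun i => if b i then S i (P.agg x) else x i

end AggProblem

/-- The σ-algebra of everything defined before the simulations of iteration `k`: the iterates
`x^0, …, x^k` and the Bernoulli variables of the iterations before `k`. The decision sets carry no
σ-algebra of their own and are given the discrete one. -/
@[reducible] def sfwPast {N : ℕ} {X : Fin N → Type u} {Ω : Type w} (n : ℕ → ℕ)
    (lam : (k : ℕ) → Fin (n k) → Fin N → Ω → Bool) (x : ℕ → Ω → ∀ i, X i) (k : ℕ) :
    MeasurableSpace Ω :=
  (⨆ l ≤ k, MeasurableSpace.comap (x l) ⊤) ⊔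
    ⨆ l < k, ⨆ p : Fin (n l) × Fin N, MeasurableSpace.comap (lam l p.1 p.2) ⊤

/-- `(x^k)` is produced by the stochastic Frank-Wolfe algorithm with best responses `S`, stepsizes
`step k`, sample sizes `n k` and starting point `x0`, where `lam k j i` are the Bernoulli variables
simulated at iteration `k`. Ties in the selection of the next iterate may be broken in any way that
does not look into the future. -/
structure IsSFW {N M : ℕ} {X : Fin N → Type u} {E : Fin M → Type v}
    [∀ j, NormedAddCommGroup (E j)] [∀ j, InnerProductSpace ℝ (E j)]
    {Ω : Type w} [MeasurableSpace Ω] (Pr : Measure Ω)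
    (P : AggProblem N M X E) (S : (i : Fin N) → PiLp 2 E → X i)
    (step : ℕ → ℝ) (n : ℕ → ℕ) (x0 : ∀ i, X i)
    (lam : (k : ℕ) → Fin (n k) → Fin N → Ω → Bool) (x : ℕ → Ω → ∀ i, X i) : Prop where
  /-- All the variables are random variables. -/
  measurable_lam : ∀ k j i, Measurable (lam k j i)
  measurable_x : ∀ k, Measurable[_, ⊤] (x k)
  /-- Initialization. -/
  init : ∀ ω, x 0 ω = x0
  /-- The variables simulated at iteration `k` are Bernoulli with parameter `step k`. -/
  bernoulli : ∀ k j i, Pr {ω | lam k j i ω = true} = ENNReal.ofReal (step k)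
  /-- They are independent of each other and of everything defined before. -/
  indep_same : ∀ k, iIndepFun (fun p : Fin (n k) × Fin N => lam k p.1 p.2) Pr
  indep_past : ∀ k, Indep (⨆ p : Fin (n k) × Fin N, MeasurableSpace.comap (lam k p.1 p.2) ⊤)
    (sfwPast n lam x k) Pr
  /-- The next iterate is one of the `n k` candidates with the smallest cost. -/
  select_mem : ∀ k ω, ∃ j, x (k + 1) ω = P.candidate S (x k ω) fun i => lam k j i ω
  select_min : ∀ k ω j,
    P.cost (x (k + 1) ω) ≤ P.cost (P.candidate S (x k ω) fun i => lam k j i ω)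

/-- `v_K = 2 C₀² / (K² (K+1)²) ∑_{k=1}^{K-1} k (k+1)² / n_k`. -/
def sfwV (C₀ : ℝ) (n : ℕ → ℕ) (K : ℕ) : ℝ :=
  2 * C₀ ^ 2 / ((K : ℝ) ^ 2 * ((K : ℝ) + 1) ^ 2) *
    ∑ k ∈ Finset.Ico 1 K, (k : ℝ) * ((k : ℝ) + 1) ^ 2 / (n k : ℝ)

/-- `m_K = C₀ / (K (K+1)) max_{1 ≤ k ≤ K-1} (k+1) (k+2) / n_k`, the maximum over the empty set
being zero. -/
def sfwM (C₀ : ℝ) (n : ℕ → ℕ) (K : ℕ) : ℝ :=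
  C₀ / ((K : ℝ) * ((K : ℝ) + 1)) *
    sSup ((fun k : ℕ => ((k : ℝ) + 1) * ((k : ℝ) + 2) / (n k : ℝ)) '' Set.Ico 1 K)

/-- `exp (-a / b)` for `a > 0` and `b ≥ 0`, with the value `exp (-∞) = 0` at `b = 0`. -/
def expNegDiv (a b : ℝ) : ℝ := if b = 0 then 0 else Real.exp (-a / b)

end

/-!
Conditionally on the past, the average cost of the candidates of iteration `k` is a function of
independent Bernoulli bits with parameter `ω_k`, and flipping one bit changes it by at most
`C₀ / (N n_k)`. Two facts about it carry the proof.

*Mean.* The descent lemma for `f`, the optimality of the best responses and the convexity of `f`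
bound its conditional mean (`AggProblem.Regular.bernMean_avgCost_le`): the gap is contracted by
`1 - ω_k`, up to the error `C₁ / 2 * (ω_k ^ 2 + ω_k (1 - ω_k) / N)`. As `k ≤ 2 N`, this error is at
most `4 C₁ / (k + 2) ^ 2`. The selected candidate is no worse than the average, so multiplying by
`(k + 1) (k + 2)` and telescoping gives the pointwise bound `γ_K ≤ 4 C₁ / K + Y`
(`IsSFW.gap_le`), where `Y` is a weighted sum of the deviations of the average costs from their
conditional means, hence the final value of a martingale.

*Fluctuation.* Revealing the bits one at a time, the deviation of a function of independent bits
from its mean has a variance of Efron–Stein type (`bernMean_sq_sub_le`) and a moment generating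
function of Bernstein type (`bernMean_exp_sub_le`). Both are finite computations on a Boolean cube.
As the bits of iteration `k` are independent of the past, they can be averaged out first
(`integral_comp_bits`), which propagates the bounds along the martingale: `Y` is centered, its
second moment is at most `v_K / N`, and its moment generating function obeys the Bernstein bound
with variance `v_K / N` and increments `m_K / N`.

All the claims follow from `0 ≤ γ_K ≤ 4 C₁ / K + Y` (`concentration_of_le_add`). Every iterate takes
finitely many values, so all the random variables are bounded.
-/

noncomputable section

/-! ### Functions of independent Bernoulli bits -/

section BernMean

variable {ι κ : Type*} [DecidableEq ι] [DecidableEq κ]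

/-- `F` changes by at most `c` when a single Boolean coordinate is flipped. -/
def BoundedDiff (c : ℝ) (F : (ι → Bool) → ℝ) : Prop :=
  ∀ b i, |F (Function.update b i true) - F (Function.update b i false)| ≤ c

lemma BoundedDiff.reindex {c : ℝ} {F : (ι → Bool) → ℝ} (hF : BoundedDiff c F) (e : κ ≃ ι) :
    BoundedDiff c (fun b : κ → Bool => F (b ∘ e.symm)) := by
  intro b i
  simpa [Function.update_comp_equiv] using hF (b ∘ e.symm) (e i)

variable [Fintype ι] [Fintype κ]

/-- The expectation of `F` under independent Bernoulli variables with parameter `p`, indexed by the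
finite type `ι`, written as a finite weighted sum over all outcomes. -/
def bernMean (p : ℝ) (F : (ι → Bool) → ℝ) : ℝ :=
  ∑ b, (∏ i, if b i then p else 1 - p) * F b

lemma bernMean_add (p : ℝ) (F G : (ι → Bool) → ℝ) :
    bernMean p (fun b => F b + G b) = bernMean p F + bernMean p G := by
  simp [bernMean, mul_add, Finset.sum_add_distrib]

lemma bernMean_const_mul (p c : ℝ) (F : (ι → Bool) → ℝ) :
    bernMean p (fun b => c * F b) = c * bernMean p F := by
  simp only [bernMean, Finset.mul_sum]
  exact Finset.sum_congr rfl fun b _ => by ring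

lemma bernMean_sum {α : Type*} (p : ℝ) (s : Finset α) (F : α → (ι → Bool) → ℝ) :
    bernMean p (fun b => ∑ a ∈ s, F a b) = ∑ a ∈ s, bernMean p (F a) := by
  simp only [bernMean, Finset.mul_sum]
  exact Finset.sum_comm

lemma bernMean_prod (p : ℝ) (φ : ι → Bool → ℝ) :
    bernMean p (fun b => ∏ i, φ i (b i)) = ∏ i, (p * φ i true + (1 - p) * φ i false) := by
  have h := Finset.prod_univ_sum (fun _ : ι => (Finset.univ : Finset Bool))
    (fun i a => (if a then p else 1 - p) * φ i a)
  simp only [Fintype.piFinset_univ, Fintype.sum_bool, if_true, Bool.false_eq_true, if_false] at h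
  rw [h, bernMean]
  exact Finset.sum_congr rfl fun b _ => by rw [Finset.prod_mul_distrib]

lemma bernMean_const (p c : ℝ) : bernMean p (fun _ : ι → Bool => c) = c := by
  have h := bernMean_prod p (fun (_ : ι) (_ : Bool) => (1 : ℝ))
  have h2 := bernMean_const_mul p c (fun _ : ι → Bool => 1)
  simp only [Finset.prod_const_one, mul_one] at h h2
  rw [h2, h]
  simp

lemma bernMean_mono {p : ℝ} (hp : 0 ≤ p) (hp1 : p ≤ 1) {F G : (ι → Bool) → ℝ}
    (h : ∀ b, F b ≤ G b) : bernMean p F ≤ bernMean p G := by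
  refine Finset.sum_le_sum fun b _ => mul_le_mul_of_nonneg_left (h b) ?_
  refine Finset.prod_nonneg fun i _ => ?_
  split_ifs <;> linarith

/-- The variables are Bernoulli with parameter `p`. -/
lemma bernMean_ite (p : ℝ) (i : ι) :
    bernMean p (fun b : ι → Bool => if b i then (1 : ℝ) else 0) = p := by
  have h := bernMean_prod p (fun (k : ι) (a : Bool) => if k = i then (if a then (1 : ℝ) else 0)
    else 1)
  simp only [Finset.prod_ite_eq', Finset.mem_univ, if_true] at h
  rw [h, Finset.prod_eq_single i]
  · simp
  · intro k _ hk
    simp [hk]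
  · simp

/-- Distinct variables are uncorrelated, and a Bernoulli variable is its own square. -/
lemma bernMean_ite_mul_ite (p : ℝ) (i j : ι) :
    bernMean p (fun b : ι → Bool => (if b i then (1 : ℝ) else 0) * (if b j then (1 : ℝ) else 0)) =
      p ^ 2 + if i = j then p - p ^ 2 else 0 := by
  by_cases hij : i = j
  · subst hij
    have := bernMean_ite p i
    simpa [← ite_and] using this
  have h := bernMean_prod p (fun (k : ι) (a : Bool) =>
    (if k = i then (if a then (1 : ℝ) else 0) else 1) *
      (if k = j then (if a then (1 : ℝ) else 0) else 1))
  simp only [Finset.prod_mul_distrib, Finset.prod_ite_eq', Finset.mem_univ, if_true] at h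
  rw [h, ← Finset.mul_prod_erase _ _ (Finset.mem_univ i),
    ← Finset.mul_prod_erase _ _ (Finset.mem_erase.2 ⟨Ne.symm hij, Finset.mem_univ j⟩),
    Finset.prod_eq_one]
  · simp [hij, Ne.symm hij, sq]
  · intro k hk
    simp only [Finset.mem_erase, Finset.mem_univ, and_true] at hk
    simp [hk.1, hk.2]

lemma bernMean_reindex (p : ℝ) (e : κ ≃ ι) (F : (ι → Bool) → ℝ) :
    bernMean p F = bernMean p (fun b : κ → Bool => F (b ∘ e.symm)) := by
  refine (Fintype.sum_equiv (e.arrowCongr (Equiv.refl Bool)) _ _ fun b => ?_).symm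
  congr 1
  rw [← Equiv.prod_comp e]
  simp [Equiv.arrowCongr]

/-- Averaging over the first variable before the others. -/
lemma bernMean_cons {n : ℕ} (p : ℝ) (F : (Fin (n + 1) → Bool) → ℝ) :
    bernMean p F = bernMean p (fun b : Fin n → Bool =>
      p * F (Fin.cons true b) + (1 - p) * F (Fin.cons false b)) := by
  unfold bernMean
  rw [← (Fin.consEquiv fun _ : Fin (n + 1) => Bool).sum_comp, Fintype.sum_prod_type,
    Fintype.sum_bool, ← Finset.sum_add_distrib]
  refine Finset.sum_congr rfl fun b _ => ?_
  simp [Fin.prod_univ_succ, Fin.consEquiv]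
  ring

lemma BoundedDiff.cons_true_sub {n : ℕ} {c : ℝ} {F : (Fin (n + 1) → Bool) → ℝ}
    (hF : BoundedDiff c F) (b : Fin n → Bool) :
    |F (Fin.cons true b) - F (Fin.cons false b)| ≤ c := by
  simpa [Fin.update_cons_zero] using hF (Fin.cons true b) 0

lemma BoundedDiff.average_head {n : ℕ} {p c : ℝ} (hp : 0 ≤ p) (hp1 : p ≤ 1)
    {F : (Fin (n + 1) → Bool) → ℝ} (hF : BoundedDiff c F) :
    BoundedDiff c (fun b : Fin n → Bool =>
      p * F (Fin.cons true b) + (1 - p) * F (Fin.cons false b)) := by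
  intro b i
  have h1 := abs_le.1 (hF (Fin.cons true b) i.succ)
  have h2 := abs_le.1 (hF (Fin.cons false b) i.succ)
  simp only [← Fin.cons_update] at h1 h2
  rw [abs_le]
  constructor <;> nlinarith

lemma mul_one_sub_nonneg_of_le_one {p : ℝ} (hp : 0 ≤ p) (hp1 : p ≤ 1) : 0 ≤ p * (1 - p) :=
  mul_nonneg hp (by linarith)

/-- The Efron–Stein bound on the variance, for functions on a Boolean cube. -/
lemma bernMean_sq_sub_le {p c : ℝ} (hp : 0 ≤ p) (hp1 : p ≤ 1) {F : (ι → Bool) → ℝ}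
    (hF : BoundedDiff c F) :
    bernMean p (fun b => (F b - bernMean p F) ^ 2) ≤ Fintype.card ι * (p * (1 - p) * c ^ 2) := by
  suffices H : ∀ n, ∀ F : (Fin n → Bool) → ℝ, BoundedDiff c F →
      bernMean p (fun b => (F b - bernMean p F) ^ 2) ≤ n * (p * (1 - p) * c ^ 2) by
    have e := (Fintype.equivFin ι).symm
    have := H _ _ (hF.reindex e)
    rwa [← bernMean_reindex p e F, ← bernMean_reindex p e (fun b => (F b - bernMean p F) ^ 2)]
      at this
  intro n
  induction n with
  | zero =>
    intro F _
    simp [bernMean]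
  | succ n ih =>
    intro F hF
    have hq := mul_one_sub_nonneg_of_le_one hp hp1
    have h := ih _ (hF.average_head hp hp1)
    rw [← bernMean_cons] at h
    rw [bernMean_cons]
    set m := bernMean p F
    calc _ ≤ bernMean p (fun b : Fin n → Bool =>
            (p * F (Fin.cons true b) + (1 - p) * F (Fin.cons false b) - m) ^ 2
              + p * (1 - p) * c ^ 2) := by
          refine bernMean_mono hp hp1 fun b => ?_
          have hd := sq_le_sq' (abs_le.1 (hF.cons_true_sub b)).1 (abs_le.1 (hF.cons_true_sub b)).2
          nlinarith [mul_le_mul_of_nonneg_left hd hq]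
      _ ≤ _ := by
          rw [bernMean_add, bernMean_const]
          push_cast
          linarith

/-- Bernstein's estimate of the exponential, from `(n + 2)! ≥ 2 * 3 ^ n`. -/
lemma Real.exp_le_one_add_add_sq_div {u a : ℝ} (hu : |u| ≤ a) (ha : a < 3) :
    Real.exp u ≤ 1 + u + u ^ 2 / (2 * (1 - a / 3)) := by
  have ha0 : 0 ≤ a := (abs_nonneg u).trans hu
  have h1 : HasSum (fun n : ℕ => u ^ n / n.factorial) (Real.exp u) := by
    rw [Real.exp_eq_exp_ℝ]
    simpa [div_eq_inv_mul] using NormedSpace.exp_series_hasSum_exp' (𝕂 := ℝ) u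
  have h2 := (hasSum_nat_add_iff' 2).2 h1
  have h3 : HasSum (fun n : ℕ => u ^ 2 / 2 * (a / 3) ^ n) (u ^ 2 / 2 * (1 - a / 3)⁻¹) :=
    (hasSum_geometric_of_lt_one (by positivity) (by linarith)).mul_left _
  have h4 := hasSum_le (fun n : ℕ => ?_) h2 h3
  · simp only [Finset.sum_range_succ, Finset.sum_range_zero] at h4
    have : u ^ 2 / (2 * (1 - a / 3)) = u ^ 2 / 2 * (1 - a / 3)⁻¹ := by
      rw [div_mul_eq_div_div, div_eq_mul_inv (u ^ 2 / 2)]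
    rw [this]
    simp at h4
    linarith
  · have hf : (2 : ℝ) * 3 ^ n ≤ ((n + 2).factorial : ℝ) := by
      have := Nat.factorial_mul_pow_le_factorial (m := 2) (n := n)
      rw [Nat.add_comm n 2]
      exact_mod_cast this
    calc u ^ (n + 2) / ((n + 2).factorial : ℝ) ≤ |u| ^ (n + 2) / ((n + 2).factorial : ℝ) := by
          rw [← abs_pow]
          exact div_le_div_of_nonneg_right (le_abs_self _) (by positivity)
      _ ≤ (u ^ 2 * a ^ n) / (2 * 3 ^ n) := by
          rw [pow_add, mul_comm (|u| ^ n), sq_abs]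
          gcongr
      _ = _ := by
          rw [div_pow]
          ring

/-- Bernstein's bound on the moment generating function of a centered two-valued variable. -/
lemma two_point_exp_le {p c s a d : ℝ} (hp : 0 ≤ p) (hp1 : p ≤ 1) (hs : 0 ≤ s)
    (hsc : p = 1 ∨ s * c ≤ a) (ha : a < 3) (hd : |d| ≤ c) :
    p * Real.exp (s * ((1 - p) * d)) + (1 - p) * Real.exp (s * (-p * d)) ≤
      Real.exp (p * (1 - p) * c ^ 2 * (s ^ 2 / (2 * (1 - a / 3)))) := by
  -- For `p = 1` the variable is constant, and no bound on `d` is needed.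
  rcases hsc with rfl | hsc
  · simp
  have hq := mul_one_sub_nonneg_of_le_one hp hp1
  have hb : ∀ t : ℝ, |t| ≤ 1 → |s * (t * d)| ≤ a := by
    intro t ht
    rw [abs_mul, abs_mul, abs_of_nonneg hs]
    refine le_trans (mul_le_mul_of_nonneg_left ?_ hs) hsc
    nlinarith [abs_nonneg d, abs_nonneg t]
  have e1 := Real.exp_le_one_add_add_sq_div
    (hb (1 - p) (by rw [abs_le]; constructor <;> linarith)) ha
  have e2 := Real.exp_le_one_add_add_sq_div
    (hb (-p) (by rw [abs_le]; constructor <;> linarith)) ha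
  have hd2 : d ^ 2 ≤ c ^ 2 := sq_le_sq' (abs_le.1 hd).1 (abs_le.1 hd).2
  set r := s ^ 2 / (2 * (1 - a / 3)) with hr
  have hr0 : 0 ≤ r := div_nonneg (sq_nonneg _) (by linarith)
  have hdiv : ∀ t, (s * (t * d)) ^ 2 / (2 * (1 - a / 3)) = t ^ 2 * d ^ 2 * r := by
    intro t
    rw [hr]
    ring
  rw [hdiv] at e1 e2
  have e3 := mul_le_mul_of_nonneg_left e1 hp
  have e4 := mul_le_mul_of_nonneg_left e2 (by linarith : 0 ≤ 1 - p)
  have e5 := Real.add_one_le_exp (p * (1 - p) * c ^ 2 * r)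
  have e6 : p * (1 - p) * d ^ 2 * r ≤ p * (1 - p) * c ^ 2 * r := by gcongr
  refine le_trans (add_le_add e3 e4) (le_trans ?_ e5)
  linarith

/-- Bernstein's bound on the moment generating function, for functions on a Boolean cube with
bounded differences: revealing the bits one by one writes the deviation as a martingale.
For `p = 1` the bits are deterministic, so that no condition on `s * c` is needed. -/
lemma bernMean_exp_sub_le {p c s a : ℝ} (hp : 0 ≤ p) (hp1 : p ≤ 1) (hs : 0 ≤ s)
    (hsc : p = 1 ∨ s * c ≤ a) (ha : a < 3) {F : (ι → Bool) → ℝ} (hF : BoundedDiff c F) :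
    bernMean p (fun b => Real.exp (s * (F b - bernMean p F))) ≤
      Real.exp (Fintype.card ι * (p * (1 - p) * c ^ 2 * (s ^ 2 / (2 * (1 - a / 3))))) := by
  suffices H : ∀ n, ∀ F : (Fin n → Bool) → ℝ, BoundedDiff c F →
      bernMean p (fun b => Real.exp (s * (F b - bernMean p F))) ≤
        Real.exp (n * (p * (1 - p) * c ^ 2 * (s ^ 2 / (2 * (1 - a / 3))))) by
    have e := (Fintype.equivFin ι).symm
    have := H _ _ (hF.reindex e)
    rwa [← bernMean_reindex p e F,
      ← bernMean_reindex p e (fun b => Real.exp (s * (F b - bernMean p F)))] at this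
  intro n
  induction n with
  | zero =>
    intro F _
    simp [bernMean]
  | succ n ih =>
    intro F hF
    have h := ih _ (hF.average_head hp hp1)
    rw [← bernMean_cons] at h
    rw [bernMean_cons]
    set m := bernMean p F
    set B := p * (1 - p) * c ^ 2 * (s ^ 2 / (2 * (1 - a / 3))) with hB
    calc _ ≤ bernMean p (fun b : Fin n → Bool => Real.exp B * Real.exp (s *
            (p * F (Fin.cons true b) + (1 - p) * F (Fin.cons false b) - m))) := by
          refine bernMean_mono hp hp1 fun b => ?_
          have hd := two_point_exp_le hp hp1 hs hsc ha (hF.cons_true_sub b)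
          rw [← hB] at hd
          refine le_trans (le_of_eq ?_) (mul_le_mul_of_nonneg_right hd (Real.exp_pos _).le)
          rw [add_mul, mul_assoc, mul_assoc, ← Real.exp_add, ← Real.exp_add]
          congr 3 <;> ring_nf
      _ ≤ _ := by
          rw [bernMean_const_mul]
          have e : ((n + 1 : ℕ) : ℝ) * B = B + n * B := by
            push_cast
            ring
          rw [e, Real.exp_add]
          exact mul_le_mul_of_nonneg_left h (Real.exp_pos _).le

end BernMean

/-! ### Convexity and descent inequalities -/

section Gradient

variable {H : Type*} [NormedAddCommGroup H] [InnerProductSpace ℝ H] [CompleteSpace H]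

lemma HasGradientAt.hasDerivAt_lineMap {f : H → ℝ} {g y z : H} {t : ℝ}
    (h : HasGradientAt f g (AffineMap.lineMap y z t)) :
    HasDerivAt (fun s : ℝ => f (AffineMap.lineMap y z s)) ⟪g, z - y⟫_ℝ t := by
  have := h.hasFDerivAt.comp_hasDerivAt t (AffineMap.hasDerivAt_lineMap (a := y) (b := z))
  rwa [InnerProductSpace.toDual_apply_apply] at this

lemma ConvexOn.add_inner_sub_le {f : H → ℝ} {g y : H} (hf : ConvexOn ℝ Set.univ f)
    (h : HasGradientAt f g y) (z : H) : f y + ⟪g, z - y⟫_ℝ ≤ f z := by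
  have hc := hf.comp_affineMap (AffineMap.lineMap y z : ℝ →ᵃ[ℝ] H)
  have hd : HasDerivAt (f ∘ (AffineMap.lineMap y z : ℝ →ᵃ[ℝ] H)) ⟪g, z - y⟫_ℝ 0 :=
    HasGradientAt.hasDerivAt_lineMap (by simpa using h)
  have := hc.le_slope_of_hasDerivAt (x := 0) (y := 1) (by simp) (by simp) one_pos hd
  simp [slope] at this
  linarith

/-- The descent lemma: a quadratic upper bound from a Lipschitz gradient. -/
lemma le_add_inner_add_sq_of_lipschitz_gradient {f : H → ℝ} {s : Set H} (hs : Convex ℝ s)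
    {C : ℝ≥0} (hd : ∀ y ∈ s, DifferentiableAt ℝ f y) (hl : LipschitzOnWith C (∇ f) s)
    {y z : H} (hy : y ∈ s) (hz : z ∈ s) :
    f z ≤ f y + ⟪∇ f y, z - y⟫_ℝ + C / 2 * ‖z - y‖ ^ 2 := by
  have hmem : ∀ t ∈ Set.Icc (0 : ℝ) 1, (AffineMap.lineMap y z t : H) ∈ s := fun t ht =>
    hs.lineMap_mem hy hz ht
  have hder : ∀ t ∈ Set.Icc (0 : ℝ) 1, HasDerivAt (fun t : ℝ => f (AffineMap.lineMap y z t) -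
      t * ⟪∇ f y, z - y⟫_ℝ - C / 2 * ‖z - y‖ ^ 2 * t ^ 2)
      (⟪∇ f (AffineMap.lineMap y z t), z - y⟫_ℝ - ⟪∇ f y, z - y⟫_ℝ - C * ‖z - y‖ ^ 2 * t) t := by
    intro t ht
    have h1 := (hd _ (hmem t ht)).hasGradientAt.hasDerivAt_lineMap
    have h2 := (hasDerivAt_id t).mul_const ⟪∇ f y, z - y⟫_ℝ
    have h3 := ((hasDerivAt_id t).pow 2).const_mul (C / 2 * ‖z - y‖ ^ 2)
    refine ((h1.sub h2).sub h3).congr_deriv ?_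
    simp
    ring
  have hanti := antitoneOn_of_deriv_nonpos (convex_Icc (0 : ℝ) 1)
    (fun t ht => (hder t ht).continuousAt.continuousWithinAt)
    (fun t ht => (hder t (interior_subset ht)).differentiableAt.differentiableWithinAt)
    (fun t ht => by
      have ht := interior_subset ht
      rw [(hder t ht).deriv, ← inner_sub_left]
      have h1 := real_inner_le_norm (∇ f (AffineMap.lineMap y z t) - ∇ f y) (z - y)
      have h2 := hl.norm_sub_le (hmem t ht) hy
      have h3 : ‖(AffineMap.lineMap y z t : H) - y‖ = t * ‖z - y‖ := by
        rw [AffineMap.lineMap_apply, vsub_eq_sub, vadd_eq_add, add_sub_cancel_right, norm_smul,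
          Real.norm_of_nonneg ht.1]
      rw [h3] at h2
      nlinarith [mul_le_mul_of_nonneg_right h2 (norm_nonneg (z - y))])
  have := hanti (Set.left_mem_Icc.2 zero_le_one) (Set.right_mem_Icc.2 zero_le_one) zero_le_one
  simp only [AffineMap.lineMap_apply_one, AffineMap.lineMap_apply_zero] at this
  linarith

end Gradient

/-- The second moment of a sum of vectors, each selected independently with probability `p`. -/
lemma bernMean_norm_sum_sq {κ ι H : Type*} [Fintype κ] [DecidableEq κ] [Fintype ι]
    [NormedAddCommGroup H] [InnerProductSpace ℝ H] (p : ℝ) (e : ι ↪ κ) (v : ι → H) :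
    bernMean p (fun b : κ → Bool => ‖∑ i, (if b (e i) then (1 : ℝ) else 0) • v i‖ ^ 2) =
      p ^ 2 * ‖∑ i, v i‖ ^ 2 + (p - p ^ 2) * ∑ i, ‖v i‖ ^ 2 := by
  classical
  have h1 : ∀ a : ι → ℝ, ‖∑ i, a i • v i‖ ^ 2 =
      ∑ i, ∑ j, ⟪v i, v j⟫_ℝ * (a i * a j) := by
    intro a
    rw [← real_inner_self_eq_norm_sq, sum_inner]
    simp_rw [inner_sum, real_inner_smul_left, real_inner_smul_right]
    exact Finset.sum_congr rfl fun i _ => Finset.sum_congr rfl fun j _ => by ring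
  have h2 := h1 fun _ => 1
  simp only [one_smul, mul_one] at h2
  simp_rw [h1, bernMean_sum, bernMean_const_mul, bernMean_ite_mul_ite, mul_add,
    Finset.sum_add_distrib, e.injective.eq_iff, mul_ite, mul_zero, Finset.sum_ite_eq,
    Finset.mem_univ, if_true, real_inner_self_eq_norm_sq, ← Finset.sum_mul]
  rw [← h2]
  ring

/-! ### One step of the method, in conditional mean -/

namespace AggProblem

variable {N M : ℕ} {X : Fin N → Type u} {E : Fin M → Type v}
  [∀ j, NormedAddCommGroup (E j)]
  {P : AggProblem N M X E} {L Lt : Fin M → ℝ≥0}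

lemma diam_nonneg (i : Fin N) (j : Fin M) : 0 ≤ P.diam i j := Metric.diam_nonneg

lemma C₀_nonneg : 0 ≤ P.C₀ L :=
  Finset.sum_nonneg fun j _ => mul_nonneg (L j).coe_nonneg
    (Real.iSup_nonneg fun i => diam_nonneg i j)

lemma C₁_nonneg : 0 ≤ P.C₁ Lt :=
  mul_nonneg (by positivity) (Finset.sum_nonneg fun j _ => mul_nonneg (Lt j).coe_nonneg
    (Finset.sum_nonneg fun i _ => sq_nonneg _))

variable [∀ j, InnerProductSpace ℝ (E j)] {S : (i : Fin N) → PiLp 2 E → X i}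

lemma agg_apply (x : ∀ i, X i) (j : Fin M) :
    P.agg x j = (N : ℝ)⁻¹ • ∑ i, P.g i j (x i) := by
  simp [agg, gVec]

lemma agg_apply_mem_aggRange (x : ∀ i, X i) (j : Fin M) : P.agg x j ∈ P.aggRange j := by
  rw [agg_apply, aggRange]
  exact Set.smul_mem_smul_set ((Set.mem_finsetSum _ _ _).2
    ⟨fun i => P.g i j (x i), fun _ => ⟨_, rfl⟩, rfl⟩)

lemma agg_apply_mem (x : ∀ i, X i) (j : Fin M) : P.agg x j ∈ convexHull ℝ (P.aggRange j) :=
  subset_convexHull ℝ _ (agg_apply_mem_aggRange x j)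

lemma agg_candidate_apply_sub (x : ∀ i, X i) (b : Fin N → Bool) (j : Fin M) :
    P.agg (P.candidate S x b) j - P.agg x j = (N : ℝ)⁻¹ • ∑ i, (if b i then (1 : ℝ) else 0) •
      (P.g i j (S i (P.agg x)) - P.g i j (x i)) := by
  rw [agg_apply, agg_apply, ← smul_sub, ← Finset.sum_sub_distrib]
  congr 1
  refine Finset.sum_congr rfl fun i _ => ?_
  cases h : b i <;> simp [candidate, h]

lemma convexOn_fTot (hc : P.ConvexCost) : ConvexOn ℝ Set.univ P.fTot := by
  refine ⟨convex_univ, fun y _ z _ a b ha hb hab => ?_⟩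
  simp only [fTot, smul_eq_mul, Finset.mul_sum, ← Finset.sum_add_distrib]
  exact Finset.sum_le_sum fun j _ => (hc.convex j).2 (Set.mem_univ _) (Set.mem_univ _) ha hb hab

lemma le_inner_finMean {Ω : Type*} {H : Type*} [NormedAddCommGroup H] [InnerProductSpace ℝ H]
    {F : Ω → H} {a : H} {c : ℝ} (hc : ∀ x, c ≤ ⟪a, F x⟫_ℝ) {μ : Ω →₀ ℝ} (hμ : μ ∈ finDistr Ω) :
    c ≤ ⟪a, finMean μ F⟫_ℝ := by
  have hlin : IsLinearMap ℝ fun μ : Ω →₀ ℝ => ⟪a, finMean μ F⟫_ℝ :=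
    ((innerSL ℝ a).toLinearMap ∘ₗ Finsupp.linearCombination ℝ F).isLinear
  refine convexHull_min (t := {μ | c ≤ ⟪a, finMean μ F⟫_ℝ}) ?_ (convex_halfSpace_ge hlin c) hμ
  rintro _ ⟨x, rfl⟩
  simpa [finMean] using hc x

lemma cost_mem_image_relaxedCost (x : ∀ i, X i) :
    P.cost x ∈ P.relaxedCost '' {μ | ∀ i, μ i ∈ finDistr (X i)} :=
  ⟨fun i => Finsupp.single (x i) 1, fun i => subset_convexHull ℝ _ ⟨x i, rfl⟩, by
    simp [relaxedCost, finMean, cost, agg]⟩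

variable [∀ j, CompleteSpace (E j)]

lemma Regular.differentiableAt (h : P.Regular L Lt) {j : Fin M} {y : E j}
    (hy : y ∈ convexHull ℝ (P.aggRange j)) : DifferentiableAt ℝ (P.f j) y := by
  obtain ⟨U, hU, hsub, hc⟩ := h.contDiff j
  exact (hc.differentiableOn one_ne_zero).differentiableAt (hU.mem_nhds (hsub hy))

lemma Regular.norm_g_sub_le (h : P.Regular L Lt) (i : Fin N) (j : Fin M) (a b : X i) :
    ‖P.g i j a - P.g i j b‖ ≤ P.diam i j := by
  rw [← dist_eq_norm]
  exact Metric.dist_le_diam_of_mem (h.bounded i j) ⟨a, rfl⟩ ⟨b, rfl⟩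

lemma Regular.hasGradientAt_fTot (h : P.Regular L Lt) (x : ∀ i, X i) :
    HasGradientAt P.fTot (WithLp.toLp 2 fun j => ∇ (P.f j) (P.agg x j)) (P.agg x) := by
  rw [hasGradientAt_iff_hasFDerivAt]
  have h1 : ∀ j ∈ Finset.univ, HasFDerivAt (fun y : PiLp 2 E => P.f j (y j))
      ((InnerProductSpace.toDual ℝ (E j) (∇ (P.f j) (P.agg x j))).comp
        (PiLp.proj 2 E j : PiLp 2 E →L[ℝ] E j)) (P.agg x) := fun j _ =>
    ((h.differentiableAt (agg_apply_mem x j)).hasGradientAt.hasFDerivAt).comp (P.agg x)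
      (PiLp.proj (𝕜 := ℝ) 2 E j).hasFDerivAt
  refine (HasFDerivAt.fun_sum h1).congr_fderiv ?_
  ext v
  simp [PiLp.inner_apply]

lemma Regular.gradient_fTot_apply (h : P.Regular L Lt) (x : ∀ i, X i) (j : Fin M) :
    (∇ P.fTot (P.agg x)) j = ∇ (P.f j) (P.agg x j) := by
  rw [(h.hasGradientAt_fTot x).gradient]

/-- The Frank–Wolfe gap at `x` bounds the optimality gap with respect to the relaxed problem. -/
lemma Regular.cost_add_inner_le_relaxedCost (h : P.Regular L Lt) (hc : P.ConvexCost)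
    (hS : P.IsBestResponse S) (x : ∀ i, X i) {μ : ∀ i, X i →₀ ℝ} (hμ : ∀ i, μ i ∈ finDistr (X i)) :
    P.cost x + ⟪∇ P.fTot (P.agg x), P.agg (fun i => S i (P.agg x)) - P.agg x⟫_ℝ ≤
      P.relaxedCost μ := by
  have hg := h.hasGradientAt_fTot x
  rw [← hg.gradient] at hg
  refine le_trans ?_ ((convexOn_fTot hc).add_inner_sub_le hg _)
  rw [inner_sub_right, inner_sub_right]
  have hle : ⟪∇ P.fTot (P.agg x), P.agg fun i => S i (P.agg x)⟫_ℝ ≤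
      ⟪∇ P.fTot (P.agg x), (N : ℝ)⁻¹ • ∑ i, finMean (μ i) (P.gVec i)⟫_ℝ := by
    rw [show P.agg (fun i => S i (P.agg x)) = (N : ℝ)⁻¹ • ∑ i, P.gVec i (S i (P.agg x)) from rfl,
      real_inner_smul_right, real_inner_smul_right,
      inner_sum, inner_sum]
    gcongr with i
    exact le_inner_finMean (hS i _ (subset_convexHull ℝ _ ⟨x, rfl⟩)) (hμ i)
  unfold cost
  linarith

lemma Regular.inner_best_response_le_neg_gap (h : P.Regular L Lt) (hc : P.ConvexCost)
    (hS : P.IsBestResponse S) (x : ∀ i, X i) :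
    ⟪∇ P.fTot (P.agg x), P.agg (fun i => S i (P.agg x)) - P.agg x⟫_ℝ ≤
      -(P.cost x - P.relaxedValue) := by
  have : P.cost x + ⟪∇ P.fTot (P.agg x), P.agg (fun i => S i (P.agg x)) - P.agg x⟫_ℝ ≤
      P.relaxedValue := by
    refine le_csInf ⟨_, cost_mem_image_relaxedCost x⟩ ?_
    rintro _ ⟨μ, hμ, rfl⟩
    exact h.cost_add_inner_le_relaxedCost hc hS x hμ
  linarith

lemma Regular.relaxedValue_le_cost (h : P.Regular L Lt) (hc : P.ConvexCost)
    (hS : P.IsBestResponse S) (x : ∀ i, X i) : P.relaxedValue ≤ P.cost x := by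
  refine csInf_le ⟨P.cost x + ⟪∇ P.fTot (P.agg x),
    P.agg (fun i => S i (P.agg x)) - P.agg x⟫_ℝ, ?_⟩ (cost_mem_image_relaxedCost x)
  rintro _ ⟨μ, hμ, rfl⟩
  exact h.cost_add_inner_le_relaxedCost hc hS x hμ

lemma Regular.cost_le (h : P.Regular L Lt) (x x' : ∀ i, X i) :
    P.cost x' ≤ P.cost x + ⟪∇ P.fTot (P.agg x), P.agg x' - P.agg x⟫_ℝ +
      ∑ j, (Lt j : ℝ) / 2 * ‖P.agg x' j - P.agg x j‖ ^ 2 := by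
  rw [PiLp.inner_apply, cost, cost, fTot, fTot, ← Finset.sum_add_distrib, ← Finset.sum_add_distrib]
  refine Finset.sum_le_sum fun j _ => ?_
  rw [h.gradient_fTot_apply]
  exact le_add_inner_add_sq_of_lipschitz_gradient (convex_convexHull ℝ _)
    (fun y hy => h.differentiableAt hy) (h.lipschitz_gradient j) (agg_apply_mem x j)
    (agg_apply_mem x' j)

/-- Expected decrease of the criterion when every agent independently moves to its best response
with probability `p`: the term `p ^ 2` is the deterministic Frank–Wolfe error, and
`p * (1 - p) / N` is the effect of the randomization. -/
lemma Regular.bernMean_cost_candidate_le (h : P.Regular L Lt) (hc : P.ConvexCost)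
    (hS : P.IsBestResponse S) {κ : Type*} [Fintype κ] [DecidableEq κ] (e : Fin N ↪ κ)
    {p : ℝ} (hp : 0 ≤ p) (hp1 : p ≤ 1) (x : ∀ i, X i) :
    bernMean p (fun b : κ → Bool => P.cost (P.candidate S x fun i => b (e i))) ≤
      P.cost x - p * (P.cost x - P.relaxedValue) +
        P.C₁ Lt / 2 * (p ^ 2 + p * (1 - p) / N) := by
  set G := ∇ P.fTot (P.agg x) with hG
  set v : Fin N → (j : Fin M) → E j := fun i j => P.g i j (S i (P.agg x)) - P.g i j (x i)
  have hlin : ∀ b : κ → Bool, ⟪G, P.agg (P.candidate S x fun i => b (e i)) - P.agg x⟫_ℝ =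
      ∑ i, (N : ℝ)⁻¹ * ⟪G, WithLp.toLp 2 (v i)⟫_ℝ * (if b (e i) then (1 : ℝ) else 0) := by
    intro b
    have : P.agg (P.candidate S x fun i => b (e i)) - P.agg x =
        (N : ℝ)⁻¹ • ∑ i, (if b (e i) then (1 : ℝ) else 0) • WithLp.toLp 2 (v i) := by
      ext j
      rw [PiLp.sub_apply, agg_candidate_apply_sub, PiLp.smul_apply, WithLp.ofLp_sum,
        Finset.sum_apply]
      rfl
    rw [this, real_inner_smul_right, inner_sum, Finset.mul_sum]
    refine Finset.sum_congr rfl fun i _ => ?_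
    rw [real_inner_smul_right]
    ring
  have hgap : ∑ i, (N : ℝ)⁻¹ * ⟪G, WithLp.toLp 2 (v i)⟫_ℝ ≤ -(P.cost x - P.relaxedValue) := by
    refine le_trans (le_of_eq ?_) (h.inner_best_response_le_neg_gap hc hS x)
    have : P.agg (fun i => S i (P.agg x)) - P.agg x = (N : ℝ)⁻¹ • ∑ i, WithLp.toLp 2 (v i) := by
      ext j
      rw [PiLp.sub_apply, agg_apply, agg_apply, ← smul_sub, ← Finset.sum_sub_distrib]
      simp [v]
    rw [this, real_inner_smul_right, inner_sum, Finset.mul_sum]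
  have hv : ∀ i j, ‖v i j‖ ^ 2 ≤ P.diam i j ^ 2 := fun i j =>
    pow_le_pow_left₀ (norm_nonneg _) (h.norm_g_sub_le i j _ _) 2
  have hquad : ∀ j, bernMean p (fun b : κ → Bool =>
      ‖P.agg (P.candidate S x fun i => b (e i)) j - P.agg x j‖ ^ 2) ≤
      (N : ℝ)⁻¹ * (p ^ 2 + p * (1 - p) / N) * ∑ i, P.diam i j ^ 2 := by
    intro j
    simp_rw [agg_candidate_apply_sub, norm_smul, mul_pow]
    rw [bernMean_const_mul, bernMean_norm_sum_sq p e fun i => v i j, Real.norm_of_nonneg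
      (by positivity)]
    -- Cauchy–Schwarz
    have hcs : ‖∑ i, v i j‖ ^ 2 ≤ N * ∑ i, ‖v i j‖ ^ 2 := by
      have := sq_sum_le_card_mul_sum_sq (s := Finset.univ) (f := fun i => ‖v i j‖)
      rw [Finset.card_univ, Fintype.card_fin] at this
      exact (pow_le_pow_left₀ (norm_nonneg _) (norm_sum_le _ _) 2).trans this
    have hq := mul_one_sub_nonneg_of_le_one hp hp1
    calc _ ≤ (N : ℝ)⁻¹ ^ 2 * (p ^ 2 * (N * ∑ i, ‖v i j‖ ^ 2) + (p - p ^ 2) * ∑ i, ‖v i j‖ ^ 2) := by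
          gcongr
      _ = (N : ℝ)⁻¹ * (p ^ 2 + p * (1 - p) / N) * ∑ i, ‖v i j‖ ^ 2 := by
          rcases eq_or_ne (N : ℝ) 0 with h0 | h0
          · simp [h0]
          · field_simp
      _ ≤ _ := by
          have := Finset.sum_le_sum fun i (_ : i ∈ Finset.univ) => hv i j
          gcongr
  have hmono := bernMean_mono hp hp1 fun b : κ → Bool =>
    h.cost_le x (P.candidate S x fun i => b (e i))
  simp only [← hG, hlin, bernMean_add, bernMean_const, bernMean_sum, bernMean_const_mul,
    bernMean_ite, ← Finset.sum_mul] at hmono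
  refine hmono.trans ?_
  have h1 := mul_le_mul_of_nonneg_right hgap hp
  have h2 : ∑ j, (Lt j : ℝ) / 2 * bernMean p (fun b : κ → Bool =>
      ‖P.agg (P.candidate S x fun i => b (e i)) j - P.agg x j‖ ^ 2) ≤
      P.C₁ Lt / 2 * (p ^ 2 + p * (1 - p) / N) := by
    refine (Finset.sum_le_sum fun j _ => mul_le_mul_of_nonneg_left (hquad j)
      (by positivity)).trans (le_of_eq ?_)
    rw [C₁, Finset.mul_sum, Finset.sum_div, Finset.sum_mul]
    exact Finset.sum_congr rfl fun j _ => by ring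
  linarith

/-- Moving a single agent changes the criterion by at most `C₀ / N`. -/
lemma Regular.boundedDiff_cost_candidate (h : P.Regular L Lt) (x : ∀ i, X i) :
    BoundedDiff (P.C₀ L / N) (fun b => P.cost (P.candidate S x b)) := by
  intro b i
  set y := P.candidate S x (Function.update b i true)
  set z := P.candidate S x (Function.update b i false)
  have hk : ∀ k, k ≠ i → y k = z k := fun k hk => by simp [y, z, candidate, hk]
  have hj : ∀ j, ‖P.agg y j - P.agg z j‖ ≤ (N : ℝ)⁻¹ * ⨆ i, P.diam i j := by
    intro j
    rw [agg_apply, agg_apply, ← smul_sub, ← Finset.sum_sub_distrib, norm_smul,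
      Real.norm_of_nonneg (by positivity), Finset.sum_eq_single i (fun k _ hki => by
        rw [hk k hki, sub_self]) (by simp)]
    gcongr
    exact (h.norm_g_sub_le i j _ _).trans (le_ciSup (f := fun i => P.diam i j)
      (Set.finite_range _).bddAbove i)
  change |∑ j, P.f j (P.agg y j) - ∑ j, P.f j (P.agg z j)| ≤ _
  rw [← Finset.sum_sub_distrib]
  refine (Finset.abs_sum_le_sum_abs _ _).trans ?_
  rw [C₀, Finset.sum_div]
  refine Finset.sum_le_sum fun j _ => ?_
  have := (h.lipschitz j).norm_sub_le (agg_apply_mem y j) (agg_apply_mem z j)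
  rw [Real.norm_eq_abs] at this
  refine this.trans ((mul_le_mul_of_nonneg_left (hj j) (L j).coe_nonneg).trans (le_of_eq ?_))
  rw [mul_div_assoc, div_eq_inv_mul]

/-- The average cost of `n` candidates, as a function of the bits drawn for all of them. -/
def avgCost (P : AggProblem N M X E) (S : (i : Fin N) → PiLp 2 E → X i) (n : ℕ) (x : ∀ i, X i)
    (b : Fin n × Fin N → Bool) : ℝ :=
  (n : ℝ)⁻¹ * ∑ j, P.cost (P.candidate S x fun i => b (j, i))

lemma Regular.boundedDiff_avgCost (h : P.Regular L Lt) (n : ℕ) (x : ∀ i, X i) :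
    BoundedDiff (P.C₀ L / (N * n)) (P.avgCost S n x) := by
  rintro b ⟨j, i⟩
  have hupd : ∀ c, (fun k => Function.update b (j, i) c (j, k)) =
      Function.update (fun k => b (j, k)) i c := by
    intro c
    ext k
    by_cases hk : k = i <;> simp [hk]
  rw [avgCost, avgCost, ← mul_sub, ← Finset.sum_sub_distrib, Finset.sum_eq_single j, hupd, hupd,
    abs_mul, abs_of_nonneg (by positivity)]
  · refine (mul_le_mul_of_nonneg_left (h.boundedDiff_cost_candidate x _ i)
      (by positivity)).trans (le_of_eq ?_)
    rw [← div_div]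
    ring
  · intro k _ hk
    simp [hk]
  · simp

lemma Regular.bernMean_avgCost_le (h : P.Regular L Lt) (hc : P.ConvexCost)
    (hS : P.IsBestResponse S) {n : ℕ} (hn : 1 ≤ n) {p : ℝ} (hp : 0 ≤ p) (hp1 : p ≤ 1)
    (x : ∀ i, X i) :
    bernMean p (P.avgCost S n x) ≤ P.cost x - p * (P.cost x - P.relaxedValue) +
        P.C₁ Lt / 2 * (p ^ 2 + p * (1 - p) / N) := by
  have hn0 : (0 : ℝ) < n := by exact_mod_cast hn
  unfold avgCost
  rw [bernMean_const_mul, bernMean_sum]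
  have := Finset.sum_le_sum fun (j : Fin n) (_ : j ∈ Finset.univ) =>
    h.bernMean_cost_candidate_le hc hS (Function.Embedding.sectR j (Fin N)) hp hp1 x
  rw [Finset.sum_const, Finset.card_univ, Fintype.card_fin, nsmul_eq_mul] at this
  rw [inv_mul_le_iff₀ hn0]
  exact this

end AggProblem

/-! ### Averaging out fresh bits -/

section Averaging

variable {Ω ι : Type*} [Fintype ι] {m0 : MeasurableSpace Ω} {lam : ι → Ω → Bool}

lemma measurableSet_forall_eq {m : MeasurableSpace Ω} (hlam : ∀ i, Measurable[m] (lam i))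
    (b : ι → Bool) : MeasurableSet[m] {ω | ∀ i, lam i ω = b i} := by
  have : {ω | ∀ i, lam i ω = b i} = ⋂ i, lam i ⁻¹' {b i} := by
    ext
    simp
  rw [this]
  exact MeasurableSet.iInter fun i => hlam i (measurableSet_singleton _)

variable {Pr : Measure Ω} [IsProbabilityMeasure Pr] {p : ℝ}

lemma measureReal_forall_eq (hp : 0 ≤ p) (hlam : ∀ i, Measurable (lam i))
    (hlaw : ∀ i, Pr {ω | lam i ω = true} = ENNReal.ofReal p) (hind : iIndepFun lam Pr)
    (b : ι → Bool) :
    Pr.real {ω | ∀ i, lam i ω = b i} = ∏ i, if b i then p else 1 - p := by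
  have : {ω | ∀ i, lam i ω = b i} = ⋂ i ∈ (Finset.univ : Finset ι), lam i ⁻¹' {b i} := by
    ext
    simp
  rw [this, measureReal_def, hind.measure_inter_preimage_eq_mul Finset.univ
    (fun i _ => measurableSet_singleton _), ENNReal.toReal_prod]
  refine Finset.prod_congr rfl fun i _ => ?_
  have ht : Pr.real (lam i ⁻¹' {true}) = p := by
    have : lam i ⁻¹' {true} = {ω | lam i ω = true} := rfl
    rw [this, measureReal_def, hlaw, ENNReal.toReal_ofReal hp]
  rw [← measureReal_def]
  cases b i
  · have : lam i ⁻¹' {false} = (lam i ⁻¹' {true})ᶜ := by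
      ext
      simp
    rw [this, probReal_compl_eq_one_sub (hlam i (measurableSet_singleton _)), ht]
    simp
  · simpa using ht

variable [DecidableEq ι]

lemma eq_sum_indicator (H : Ω → (ι → Bool) → ℝ) (ω : Ω) :
    H ω (fun i => lam i ω) =
      ∑ b, {ω | ∀ i, lam i ω = b i}.indicator (fun _ => (1 : ℝ)) ω * H ω b := by
  rw [Finset.sum_eq_single fun i => lam i ω]
  · simp
  · intro b _ hb
    have : ω ∉ {ω | ∀ i, lam i ω = b i} := fun h => hb (funext fun i => (h i).symm)
    simp [Set.indicator_of_notMem this]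
  · simp

lemma measurable_comp_bits {m : MeasurableSpace Ω} (hlam : ∀ i, Measurable[m] (lam i))
    {H : Ω → (ι → Bool) → ℝ} (hH : ∀ b, Measurable[m] fun ω => H ω b) :
    Measurable[m] fun ω => H ω fun i => lam i ω := by
  simp_rw [eq_sum_indicator H]
  exact Finset.measurable_sum _ fun b _ =>
    (measurable_const.indicator (measurableSet_forall_eq hlam b)).mul (hH b)

/-- Averaging over fresh Bernoulli variables: in an integrand depending on the past and on bits that
are independent of the past, the bits can be averaged out first. -/
lemma integral_comp_bits (hp : 0 ≤ p) (hlam : ∀ i, Measurable (lam i))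
    (hlaw : ∀ i, Pr {ω | lam i ω = true} = ENNReal.ofReal p) (hind : iIndepFun lam Pr)
    {m : MeasurableSpace Ω}
    (hpast : Indep (⨆ i, MeasurableSpace.comap (lam i) ⊤) m Pr) {H : Ω → (ι → Bool) → ℝ}
    (hH : ∀ b, Measurable[m] fun ω => H ω b) (hHi : ∀ b, Integrable (fun ω => H ω b) Pr) :
    ∫ ω, H ω (fun i => lam i ω) ∂Pr = ∫ ω, bernMean p (H ω) ∂Pr := by
  have hset : ∀ b : ι → Bool, MeasurableSet[m0] {ω | ∀ i, lam i ω = b i} :=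
    measurableSet_forall_eq hlam
  have hlam' : ∀ i, Measurable[⨆ i, MeasurableSpace.comap (lam i) ⊤] (lam i) := fun i =>
    Measurable.mono (comap_measurable (lam i))
      (le_iSup (fun i => MeasurableSpace.comap (lam i) ⊤) i) le_rfl
  have hI : ∀ b : ι → Bool, IndepFun ({ω | ∀ i, lam i ω = b i}.indicator fun _ => (1 : ℝ))
      (fun ω => H ω b) Pr := fun b =>
    indep_of_indep_of_le_left (indep_of_indep_of_le_right hpast (hH b).comap_le)
      (Measurable.comap_le (measurable_const.indicator (measurableSet_forall_eq hlam' b)))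
  have hInt : ∀ b : ι → Bool, Integrable
      ({ω | ∀ i, lam i ω = b i}.indicator fun _ => (1 : ℝ)) Pr := fun b =>
    (integrable_const 1).indicator (hset b)
  simp_rw [eq_sum_indicator H, bernMean]
  have hmul : ∀ b : ι → Bool, Integrable
      (fun ω => {ω | ∀ i, lam i ω = b i}.indicator (fun _ => (1 : ℝ)) ω * H ω b) Pr := fun b =>
    (hI b).integrable_mul (hInt b) (hHi b)
  rw [integral_finsetSum _ fun b _ => hmul b, integral_finsetSum _ fun b _ => (hHi b).const_mul _]
  refine Finset.sum_congr rfl fun b _ => ?_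
  rw [(hI b).integral_fun_mul_eq_mul_integral (hInt b).aestronglyMeasurable
    (hHi b).aestronglyMeasurable, integral_const_mul, integral_indicator_const _ (hset b),
    measureReal_forall_eq hp hlam hlaw hind]
  simp

end Averaging

/-! ### Bernstein's inequality -/

section Bernstein

variable {Ω : Type*} [MeasurableSpace Ω] {Pr : Measure Ω} [IsProbabilityMeasure Pr]

lemma integrable_of_measurable_of_bound {f : Ω → ℝ} (hf : Measurable f)
    (hb : ∃ C, ∀ ω, |f ω| ≤ C) : Integrable f Pr :=
  let ⟨_, hC⟩ := hb
  Integrable.of_bound hf.aestronglyMeasurable _ (Filter.Eventually.of_forall hC)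

/-- Bernstein's inequality, from the Bernstein bound on the moment generating function. If the
variance bound `V` vanishes then the variable is zero almost surely. -/
lemma measureReal_ge_le_of_mgf_le {Y : Ω → ℝ} (hY : Measurable Y) (hYb : ∃ C, ∀ ω, |Y ω| ≤ C)
    {V m : ℝ} (hm : 0 ≤ m) (hvar : ∫ ω, Y ω ^ 2 ∂Pr ≤ V)
    (hmgf : ∀ s, 0 ≤ s → s * m < 3 →
      ∫ ω, Real.exp (s * Y ω) ∂Pr ≤ Real.exp (V * (s ^ 2 / (2 * (1 - s * m / 3)))))
    {ε : ℝ} (hε : 0 < ε) :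
    Pr.real {ω | ε ≤ Y ω} ≤ expNegDiv (ε ^ 2) (2 * (V + ε * m / 3)) := by
  obtain ⟨C, hC⟩ := hYb
  have hsq : 0 ≤ ∫ ω, Y ω ^ 2 ∂Pr := integral_nonneg fun _ => sq_nonneg _
  rcases (hsq.trans hvar).eq_or_lt with hV | hV
  · have hint : Integrable (fun ω => Y ω ^ 2) Pr :=
      integrable_of_measurable_of_bound (hY.pow_const 2) ⟨C ^ 2, fun ω => by
        rw [abs_of_nonneg (sq_nonneg _), ← sq_abs]
        exact pow_le_pow_left₀ (abs_nonneg _) (hC ω) 2⟩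
    have h0 := (integral_eq_zero_iff_of_nonneg (fun _ => sq_nonneg _) hint).1
      (le_antisymm (hvar.trans hV.symm.le) hsq)
    have hz : Pr {ω | ε ≤ Y ω} = 0 := by
      rw [← compl_mem_ae_iff]
      filter_upwards [h0] with ω hω
      have hω : Y ω = 0 := by simpa using hω
      simp [hω, hε]
    rw [measureReal_def, hz, expNegDiv]
    split_ifs <;> simp [Real.exp_nonneg]
  · have hD : 0 < V + ε * m / 3 := by positivity
    rw [expNegDiv, if_neg (by positivity)]
    -- The Chernoff parameter that turns the exponent into `-s * ε / 2`.
    set s := ε / (V + ε * m / 3) with hs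
    have hs0 : 0 ≤ s := by positivity
    have h1 : 1 - s * m / 3 = V / (V + ε * m / 3) := by
      rw [hs]
      field_simp
      ring
    have hsm : s * m < 3 := by
      have : 0 < 1 - s * m / 3 := by
        rw [h1]
        positivity
      linarith
    have hexp : Integrable (fun ω => Real.exp (s * Y ω)) Pr :=
      integrable_of_measurable_of_bound (hY.const_mul s).exp ⟨Real.exp (s * C), fun ω => by
        rw [abs_of_pos (Real.exp_pos _)]
        exact Real.exp_le_exp.2 (mul_le_mul_of_nonneg_left ((le_abs_self _).trans (hC ω)) hs0)⟩
    refine (measure_ge_le_exp_mul_mgf ε hs0 hexp).trans ?_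
    refine (mul_le_mul_of_nonneg_left (hmgf s hs0 hsm) (Real.exp_pos _).le).trans ?_
    rw [← Real.exp_add, h1, Real.exp_le_exp]
    refine le_of_eq ?_
    rw [hs]
    field_simp
    ring

end Bernstein

/-! ### The martingale of the algorithm -/

namespace IsSFW

variable {N M : ℕ} {X : Fin N → Type u} {E : Fin M → Type v}
  [∀ j, NormedAddCommGroup (E j)] [∀ j, InnerProductSpace ℝ (E j)]
  {Ω : Type w} {P : AggProblem N M X E} {S : (i : Fin N) → PiLp 2 E → X i}
  {step : ℕ → ℝ} {n : ℕ → ℕ} {x0 : ∀ i, X i}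
  {lam : (k : ℕ) → Fin (n k) → Fin N → Ω → Bool} {x : ℕ → Ω → ∀ i, X i}

/-- The deviation of the average cost of the candidates of iteration `k` from its conditional
expectation given the past. -/
def noise (P : AggProblem N M X E) (S : (i : Fin N) → PiLp 2 E → X i) (step : ℕ → ℝ) (n : ℕ → ℕ)
    (lam : (k : ℕ) → Fin (n k) → Fin N → Ω → Bool) (x : ℕ → Ω → ∀ i, X i) (k : ℕ) (ω : Ω) : ℝ :=
  P.avgCost S (n k) (x k ω) (fun q => lam k q.1 q.2 ω) -
    bernMean (step k) (P.avgCost S (n k) (x k ω))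

/-- The martingale `∑_{l < k} a_l ξ_l`, where `ξ_l` is the noise of iteration `l`. -/
def mart (P : AggProblem N M X E) (S : (i : Fin N) → PiLp 2 E → X i) (step : ℕ → ℝ) (n : ℕ → ℕ)
    (lam : (k : ℕ) → Fin (n k) → Fin N → Ω → Bool) (x : ℕ → Ω → ∀ i, X i) (a : ℕ → ℝ) (k : ℕ)
    (ω : Ω) : ℝ :=
  ∑ l ∈ Finset.range k, a l * noise P S step n lam x l ω

lemma measurable_comp_past {k l : ℕ} (hl : l ≤ k) (F : (∀ i, X i) → ℝ) :
    Measurable[sfwPast n lam x k] fun ω => F (x l ω) := by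
  have h : Measurable[sfwPast n lam x k, ⊤] (x l) := by
    rw [measurable_iff_comap_le]
    exact le_sup_of_le_left
      (le_iSup₂ (f := fun l (_ : l ≤ k) => MeasurableSpace.comap (x l) ⊤) l hl)
  exact @Measurable.comp _ _ _ _ ⊤ _ _ _ measurable_from_top h

lemma measurable_lam_past {k l : ℕ} (hl : l < k) (q : Fin (n l) × Fin N) :
    Measurable[sfwPast n lam x k] (lam l q.1 q.2) := by
  rw [measurable_iff_comap_le]
  exact le_sup_of_le_right (le_trans
    (le_iSup (fun q : Fin (n l) × Fin N => MeasurableSpace.comap (lam l q.1 q.2) ⊤) q)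
    (le_iSup₂ (f := fun l (_ : l < k) => ⨆ q : Fin (n l) × Fin N,
      MeasurableSpace.comap (lam l q.1 q.2) ⊤) l hl))

lemma measurable_noise {k l : ℕ} (hl : l < k) :
    Measurable[sfwPast n lam x k] (noise P S step n lam x l) := by
  refine Measurable.sub ?_ (measurable_comp_past hl.le
    fun y => bernMean (step l) (P.avgCost S (n l) y))
  exact measurable_comp_bits (measurable_lam_past hl)
    (H := fun ω b => P.avgCost S (n l) (x l ω) b)
    fun b => measurable_comp_past hl.le fun y => P.avgCost S (n l) y b

lemma measurable_mart_past (a : ℕ → ℝ) (k : ℕ) :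
    Measurable[sfwPast n lam x k] (mart P S step n lam x a k) := by
  have := Finset.measurable_sum (m := sfwPast n lam x k) (Finset.range k) fun l hl =>
    (measurable_noise (P := P) (S := S) (step := step) (n := n) (lam := lam) (x := x)
      (Finset.mem_range.1 hl)).const_mul (a l)
  exact this

variable [mΩ : MeasurableSpace Ω] {Pr : Measure Ω}

lemma finite_range (hx : IsSFW Pr P S step n x0 lam x) (k : ℕ) : (Set.range (x k)).Finite := by
  induction k with
  | zero =>
    refine (Set.finite_singleton x0).subset ?_
    rintro _ ⟨ω, rfl⟩
    exact hx.init ω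
  | succ k ih =>
    refine ((ih.prod (Set.finite_univ (α := Fin N → Bool))).image
      fun q => P.candidate S q.1 q.2).subset ?_
    rintro _ ⟨ω, rfl⟩
    obtain ⟨j, hj⟩ := hx.select_mem k ω
    exact ⟨(x k ω, fun i => lam k j i ω), ⟨⟨ω, rfl⟩, trivial⟩, hj.symm⟩

lemma exists_bound_comp (hx : IsSFW Pr P S step n x0 lam x) (k : ℕ) {α : Type*} [Finite α]
    (F : (∀ i, X i) → α → ℝ) (b : Ω → α) : ∃ C, ∀ ω, |F (x k ω) (b ω)| ≤ C := by
  obtain ⟨C, hC⟩ := (((hx.finite_range k).prod (Set.finite_univ (α := α))).image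
    fun q => |F q.1 q.2|).bddAbove
  exact ⟨C, fun ω => hC ⟨(x k ω, b ω), ⟨⟨ω, rfl⟩, trivial⟩, rfl⟩⟩

lemma sfwPast_le (hx : IsSFW Pr P S step n x0 lam x) (k : ℕ) : sfwPast n lam x k ≤ mΩ :=
  sup_le (iSup₂_le fun l _ => (hx.measurable_x l).comap_le)
    (iSup₂_le fun l _ => iSup_le fun q => (hx.measurable_lam l q.1 q.2).comap_le)

lemma measurable_mart (hx : IsSFW Pr P S step n x0 lam x) (a : ℕ → ℝ) (k : ℕ) :
    Measurable (mart P S step n lam x a k) :=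
  (measurable_mart_past a k).mono (hx.sfwPast_le k) le_rfl

lemma exists_bound_mart (hx : IsSFW Pr P S step n x0 lam x) (a : ℕ → ℝ) (k : ℕ) :
    ∃ C, ∀ ω, |mart P S step n lam x a k ω| ≤ C := by
  choose C hC using fun l => hx.exists_bound_comp l
    (fun y b => P.avgCost S (n l) y b - bernMean (step l) (P.avgCost S (n l) y))
    (fun ω (q : Fin (n l) × Fin N) => lam l q.1 q.2 ω)
  refine ⟨∑ l ∈ Finset.range k, |a l| * C l, fun ω => ?_⟩
  refine (Finset.abs_sum_le_sum_abs _ _).trans (Finset.sum_le_sum fun l _ => ?_)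
  rw [abs_mul]
  exact mul_le_mul_of_nonneg_left (hC l ω) (abs_nonneg _)

/-- The best of the candidates is no worse than their average. -/
lemma cost_succ_le_avgCost (hx : IsSFW Pr P S step n x0 lam x) (hn : ∀ k, 1 ≤ n k) (k : ℕ) (ω : Ω) :
    P.cost (x (k + 1) ω) ≤ P.avgCost S (n k) (x k ω) (fun q => lam k q.1 q.2 ω) := by
  have hn0 : (0 : ℝ) < n k := by exact_mod_cast hn k
  rw [AggProblem.avgCost, le_inv_mul_iff₀ hn0]
  have := Finset.sum_le_sum fun j (_ : j ∈ Finset.univ) => hx.select_min k ω j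
  simpa using this

/-- The telescoped Frank–Wolfe recursion, with the noise collected in a martingale. -/
lemma gap_le [∀ j, CompleteSpace (E j)] {L Lt : Fin M → ℝ≥0}
    (hx : IsSFW Pr P S (fun k => 2 / ((k : ℝ) + 2)) n x0 lam x)
    (hreg : P.Regular L Lt) (hconv : P.ConvexCost) (hS : P.IsBestResponse S)
    (hn : ∀ k, 1 ≤ n k) (ω : Ω) (k : ℕ) (hk : k ≤ 2 * N) :
    (k : ℝ) * (k + 1) * (P.cost (x k ω) - P.relaxedValue) ≤ 4 * P.C₁ Lt * k +
      mart P S (fun k => 2 / ((k : ℝ) + 2)) n lam x (fun l => ((l : ℝ) + 1) * (l + 2)) k ω := by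
  induction k with
  | zero => simp [mart]
  | succ k ih =>
    have ih := ih (by omega)
    have hC := AggProblem.C₁_nonneg (P := P) (Lt := Lt)
    have hN : (0 : ℝ) < N := by
      have : 0 < N := by omega
      exact_mod_cast this
    have hkN : (k : ℝ) ≤ 2 * N := by
      have : k ≤ 2 * N := by omega
      exact_mod_cast this
    have hk0 : (0 : ℝ) < (k : ℝ) + 2 := by positivity
    have hp1 : 2 / ((k : ℝ) + 2) ≤ 1 := by
      rw [div_le_one hk0]
      linarith [Nat.cast_nonneg (α := ℝ) k]
    have h1 := hx.cost_succ_le_avgCost hn k ω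
    have h2 := hreg.bernMean_avgCost_le hconv hS (hn k) (p := 2 / ((k : ℝ) + 2)) (by positivity)
      hp1 (x k ω)
    have h3 : (2 / ((k : ℝ) + 2)) ^ 2 + 2 / ((k : ℝ) + 2) * (1 - 2 / ((k : ℝ) + 2)) / N ≤
        8 / ((k : ℝ) + 2) ^ 2 := by
      have : (2 / ((k : ℝ) + 2)) ^ 2 + 2 / ((k : ℝ) + 2) * (1 - 2 / ((k : ℝ) + 2)) / N =
          (4 + 2 * (k / N)) / ((k : ℝ) + 2) ^ 2 := by
        field_simp
        ring
      rw [this]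
      -- This is where the horizon `2 * N` enters.
      have : (k : ℝ) / N ≤ 2 := by rwa [div_le_iff₀ hN]
      gcongr
      linarith
    have h4 := mul_le_mul_of_nonneg_left h3 (by positivity : 0 ≤ P.C₁ Lt / 2)
    rw [mart, Finset.sum_range_succ, ← mart, noise]
    set A := P.avgCost S (n k) (x k ω) fun q => lam k q.1 q.2 ω
    set μ := bernMean (2 / ((k : ℝ) + 2)) (P.avgCost S (n k) (x k ω))
    set Γ := P.cost (x k ω) - P.relaxedValue with hΓ
    have h5 : P.cost (x (k + 1) ω) - P.relaxedValue ≤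
        (1 - 2 / ((k : ℝ) + 2)) * Γ + P.C₁ Lt / 2 * (8 / ((k : ℝ) + 2) ^ 2) + (A - μ) := by
      have : P.cost (x k ω) = Γ + P.relaxedValue := by rw [hΓ]; ring
      rw [this] at h2
      linarith
    have h6 := mul_le_mul_of_nonneg_left h5 (by positivity : 0 ≤ ((k : ℝ) + 1) * (k + 2))
    have h7 : ((k : ℝ) + 1) * (k + 2) * ((1 - 2 / ((k : ℝ) + 2)) * Γ +
        P.C₁ Lt / 2 * (8 / ((k : ℝ) + 2) ^ 2) + (A - μ)) = k * (k + 1) * Γ +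
        4 * P.C₁ Lt * ((k + 1) / (k + 2)) + ((k : ℝ) + 1) * (k + 2) * (A - μ) := by
      field_simp
      ring
    have h8 : 4 * P.C₁ Lt * (((k : ℝ) + 1) / (k + 2)) ≤ 4 * P.C₁ Lt * 1 := by
      gcongr
      rw [div_le_one hk0]
      linarith
    rw [h7] at h6
    push_cast
    have e : ((k : ℝ) + 1) * (k + 1 + 1) = (k + 1) * (k + 2) := by ring
    rw [e]
    linarith

lemma card_mul_bits {n N : ℕ} (hn : 1 ≤ n) (c : ℝ) (q : ℝ) :
    (Fintype.card (Fin n × Fin N) : ℝ) * (q * (c / (N * n)) ^ 2) = q * c ^ 2 / (N * n) := by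
  have hn0 : (n : ℝ) ≠ 0 := by positivity
  rcases eq_or_ne (N : ℝ) 0 with h0 | h0
  · simp [h0]
  · simp only [Fintype.card_prod, Fintype.card_fin, Nat.cast_mul]
    field_simp

variable [IsProbabilityMeasure Pr]

/-- One step of the martingale: the expectation of `Φ` at time `k + 1` is obtained by first
averaging over the bits of iteration `k`. -/
lemma integral_mart_succ (hx : IsSFW Pr P S step n x0 lam x) (hstep : ∀ k, 0 ≤ step k)
    (a : ℕ → ℝ) (k : ℕ) {Φ : ℝ → ℝ} (hΦ : Continuous Φ) :
    ∫ ω, Φ (mart P S step n lam x a (k + 1) ω) ∂Pr =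
      ∫ ω, bernMean (step k) (fun b => Φ (mart P S step n lam x a k ω + a k *
        (P.avgCost S (n k) (x k ω) b - bernMean (step k) (P.avgCost S (n k) (x k ω))))) ∂Pr := by
  have hmeas : ∀ b : Fin (n k) × Fin N → Bool, Measurable[sfwPast n lam x k] fun ω =>
      mart P S step n lam x a k ω + a k *
        (P.avgCost S (n k) (x k ω) b - bernMean (step k) (P.avgCost S (n k) (x k ω))) := fun b =>
    (measurable_mart_past a k).add (measurable_comp_past le_rfl fun y =>
      a k * (P.avgCost S (n k) y b - bernMean (step k) (P.avgCost S (n k) y)))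
  have hΦm : ∀ b : Fin (n k) × Fin N → Bool, Measurable[sfwPast n lam x k] fun ω =>
      Φ (mart P S step n lam x a k ω + a k *
        (P.avgCost S (n k) (x k ω) b - bernMean (step k) (P.avgCost S (n k) (x k ω)))) := fun b =>
    hΦ.measurable.comp (hmeas b)
  rw [← integral_comp_bits (lam := fun q : Fin (n k) × Fin N => lam k q.1 q.2) (hstep k)
    (fun q => hx.measurable_lam k q.1 q.2) (fun q => hx.bernoulli k q.1 q.2) (hx.indep_same k)
    (hx.indep_past k) hΦm]
  · refine integral_congr_ae (Filter.Eventually.of_forall fun ω => ?_)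
    simp only [mart, Finset.sum_range_succ, noise]
  · intro b
    obtain ⟨C₁, h₁⟩ := hx.exists_bound_mart a k
    obtain ⟨C₂, h₂⟩ := hx.exists_bound_comp k (fun y (_ : Unit) => a k *
      (P.avgCost S (n k) y b - bernMean (step k) (P.avgCost S (n k) y))) fun _ => ()
    obtain ⟨C, hC⟩ := (isCompact_Icc (a := -(C₁ + C₂)) (b := C₁ + C₂)).exists_bound_of_continuousOn
      hΦ.continuousOn
    refine integrable_of_measurable_of_bound ((hΦm b).mono (hx.sfwPast_le k) le_rfl)
      ⟨C, fun ω => hC _ ?_⟩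
    rw [Set.mem_Icc, ← abs_le]
    exact (abs_add_le _ _).trans (add_le_add (h₁ ω) (h₂ ω))

lemma integrable_comp_mart (hx : IsSFW Pr P S step n x0 lam x) (a : ℕ → ℝ) (k : ℕ) {Φ : ℝ → ℝ}
    (hΦ : Continuous Φ) : Integrable (fun ω => Φ (mart P S step n lam x a k ω)) Pr := by
  obtain ⟨C₁, h₁⟩ := hx.exists_bound_mart a k
  obtain ⟨C, hC⟩ := (isCompact_Icc (a := -C₁) (b := C₁)).exists_bound_of_continuousOn
    hΦ.continuousOn
  refine integrable_of_measurable_of_bound (hΦ.measurable.comp (hx.measurable_mart a k))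
    ⟨C, fun ω => hC _ ?_⟩
  rw [Set.mem_Icc, ← abs_le]
  exact h₁ ω

lemma integral_mart (hx : IsSFW Pr P S step n x0 lam x) (hstep : ∀ k, 0 ≤ step k)
    (a : ℕ → ℝ) (k : ℕ) : ∫ ω, mart P S step n lam x a k ω ∂Pr = 0 := by
  induction k with
  | zero => simp [mart]
  | succ k ih =>
    refine (hx.integral_mart_succ hstep a k continuous_id).trans (Eq.trans
      (integral_congr_ae (Filter.Eventually.of_forall fun ω => ?_)) ih)
    simp only [id, sub_eq_add_neg, bernMean_add, bernMean_const, bernMean_const_mul]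
    ring

variable [∀ j, CompleteSpace (E j)] {L Lt : Fin M → ℝ≥0}

lemma integral_mart_sq_le (hx : IsSFW Pr P S step n x0 lam x) (hreg : P.Regular L Lt)
    (hn : ∀ k, 1 ≤ n k) (hstep : ∀ k, 0 ≤ step k) (hstep1 : ∀ k, step k ≤ 1) (a : ℕ → ℝ) (k : ℕ) :
    ∫ ω, mart P S step n lam x a k ω ^ 2 ∂Pr ≤
      ∑ l ∈ Finset.range k, a l ^ 2 * (step l * (1 - step l) * P.C₀ L ^ 2 / (N * n l)) := by
  induction k with
  | zero => simp [mart]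
  | succ k ih =>
    rw [hx.integral_mart_succ hstep a k (continuous_pow 2), Finset.sum_range_succ]
    set B := a k ^ 2 * (step k * (1 - step k) * P.C₀ L ^ 2 / (N * n k)) with hB
    have hle : ∀ ω, bernMean (step k) (fun b => (mart P S step n lam x a k ω + a k *
        (P.avgCost S (n k) (x k ω) b - bernMean (step k) (P.avgCost S (n k) (x k ω)))) ^ 2) ≤
        mart P S step n lam x a k ω ^ 2 + B := by
      intro ω
      set F := P.avgCost S (n k) (x k ω)
      set μ := bernMean (step k) F with hμ
      have h := bernMean_sq_sub_le (hstep k) (hstep1 k)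
        (hreg.boundedDiff_avgCost (S := S) (n k) (x k ω))
      rw [card_mul_bits (hn k), ← hμ] at h
      have e : ∀ b, (mart P S step n lam x a k ω + a k * (F b - μ)) ^ 2 =
          (mart P S step n lam x a k ω ^ 2 + -(2 * mart P S step n lam x a k ω * a k * μ)) +
            (2 * mart P S step n lam x a k ω * a k * F b + a k ^ 2 * (F b - μ) ^ 2) := by
        intro b
        ring
      simp only [e, bernMean_add, bernMean_const, bernMean_const_mul]
      rw [← hμ]
      have := mul_le_mul_of_nonneg_left h (sq_nonneg (a k))
      linarith
    refine (integral_mono_of_nonneg (Filter.Eventually.of_forall fun ω => ?_)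
      ((hx.integrable_comp_mart a k (continuous_pow 2)).add (integrable_const B))
      (Filter.Eventually.of_forall hle)).trans ?_
    · have := bernMean_mono (hstep k) (hstep1 k) fun b => sq_nonneg (mart P S step n lam x a k ω +
        a k * (P.avgCost S (n k) (x k ω) b - bernMean (step k) (P.avgCost S (n k) (x k ω))))
      rwa [bernMean_const] at this
    · have hi := hx.integrable_comp_mart a k (continuous_pow 2)
      simp only [Pi.add_apply]
      rw [integral_add hi (integrable_const B)]
      simpa using ih

/-- The Bernstein bound on the moment generating function of the martingale. The iterations with
step one are almost surely free of noise and do not enter the bound `m` on the increments. -/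
lemma integral_exp_mart_le (hx : IsSFW Pr P S step n x0 lam x) (hreg : P.Regular L Lt)
    (hn : ∀ k, 1 ≤ n k) (hstep : ∀ k, 0 ≤ step k) (hstep1 : ∀ k, step k ≤ 1) {a : ℕ → ℝ}
    (ha : ∀ k, 0 ≤ a k) {m s : ℝ} (hs : 0 ≤ s) (hsm : s * m < 3) (k : ℕ)
    (hm : ∀ l < k, step l = 1 ∨ a l * (P.C₀ L / (N * n l)) ≤ m) :
    ∫ ω, Real.exp (s * mart P S step n lam x a k ω) ∂Pr ≤
      Real.exp ((∑ l ∈ Finset.range k, a l ^ 2 *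
        (step l * (1 - step l) * P.C₀ L ^ 2 / (N * n l))) * (s ^ 2 / (2 * (1 - s * m / 3)))) := by
  induction k with
  | zero => simp [mart]
  | succ k ih =>
    have hc : Continuous fun t : ℝ => Real.exp (s * t) := by fun_prop
    rw [hx.integral_mart_succ hstep a k hc, Finset.sum_range_succ, add_mul, Real.exp_add]
    set B := a k ^ 2 * (step k * (1 - step k) * P.C₀ L ^ 2 / (N * n k)) with hB
    set r := s ^ 2 / (2 * (1 - s * m / 3)) with hr
    have hle : ∀ ω, bernMean (step k) (fun b => Real.exp (s * (mart P S step n lam x a k ω + a k *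
        (P.avgCost S (n k) (x k ω) b - bernMean (step k) (P.avgCost S (n k) (x k ω)))))) ≤
        Real.exp (s * mart P S step n lam x a k ω) * Real.exp (B * r) := by
      intro ω
      have hsc : step k = 1 ∨ s * a k * (P.C₀ L / (N * n k)) ≤ s * m :=
        (hm k k.lt_succ_self).imp_right fun h => by
          rw [mul_assoc]
          exact mul_le_mul_of_nonneg_left h hs
      have h := bernMean_exp_sub_le (hstep k) (hstep1 k) (mul_nonneg hs (ha k)) hsc hsm
        (hreg.boundedDiff_avgCost (S := S) (n k) (x k ω))
      have e : (Fintype.card (Fin (n k) × Fin N) : ℝ) * (step k * (1 - step k) *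
          (P.C₀ L / (N * n k)) ^ 2 * ((s * a k) ^ 2 / (2 * (1 - s * m / 3)))) = B * r := by
        rw [← mul_assoc, card_mul_bits (hn k), hB, hr]
        ring
      rw [e] at h
      simp only [mul_add, Real.exp_add, bernMean_const_mul, ← mul_assoc]
      exact mul_le_mul_of_nonneg_left h (Real.exp_pos _).le
    refine (integral_mono_of_nonneg (Filter.Eventually.of_forall fun ω => ?_)
      ((hx.integrable_comp_mart a k hc).mul_const _) (Filter.Eventually.of_forall hle)).trans ?_
    · have := bernMean_mono (hstep k) (hstep1 k) fun b => (Real.exp_pos (s * (mart P S step n lam x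
        a k ω + a k * (P.avgCost S (n k) (x k ω) b -
          bernMean (step k) (P.avgCost S (n k) (x k ω)))))).le
      rwa [bernMean_const] at this
    · rw [integral_mul_const]
      exact mul_le_mul_of_nonneg_right (ih fun l hl => hm l (hl.trans k.lt_succ_self))
        (Real.exp_pos _).le

end IsSFW

/-! ### Conclusions from the domination by a martingale -/

/-- The conclusions drawn from a domination `0 ≤ γ ≤ A + Y` by a centered variable `Y` with variance
bounded by `V` and with a Bernstein bound on its moment generating function. -/
lemma concentration_of_le_add {Ω : Type*} [MeasurableSpace Ω] {Pr : Measure Ω}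
    [IsProbabilityMeasure Pr] {γ Y : Ω → ℝ} {A V m : ℝ} (hγm : Measurable γ)
    (hγ0 : ∀ ω, 0 ≤ γ ω) (hγ : ∀ ω, γ ω ≤ A + Y ω) (hY : Measurable Y)
    (hYb : ∃ C, ∀ ω, |Y ω| ≤ C) (hmean : ∫ ω, Y ω ∂Pr = 0) (hvar : ∫ ω, Y ω ^ 2 ∂Pr ≤ V)
    (hm : 0 ≤ m) (hmgf : ∀ s, 0 ≤ s → s * m < 3 →
      ∫ ω, Real.exp (s * Y ω) ∂Pr ≤ Real.exp (V * (s ^ 2 / (2 * (1 - s * m / 3))))) :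
    MemLp γ 2 Pr ∧ ∫ ω, γ ω ∂Pr ≤ A ∧
    (∀ ε : ℝ, 0 < ε →
      1 - expNegDiv (ε ^ 2) (2 * (V + ε * m / 3)) ≤ Pr.real {ω | γ ω < A + ε}) ∧
    variance γ Pr ≤ A ^ 2 + V ∧ ∫ ω, (max (γ ω - A) 0) ^ 2 ∂Pr ≤ V := by
  obtain ⟨C, hC⟩ := hYb
  have hYi : Integrable Y Pr := integrable_of_measurable_of_bound hY ⟨C, hC⟩
  have hY2 : Integrable (fun ω => Y ω ^ 2) Pr :=
    integrable_of_measurable_of_bound (hY.pow_const 2) ⟨C ^ 2, fun ω => by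
      rw [abs_of_nonneg (sq_nonneg _), ← sq_abs]
      exact pow_le_pow_left₀ (abs_nonneg _) (hC ω) 2⟩
  have hγb : ∀ ω, ‖γ ω‖ ≤ A + C := fun ω => by
    rw [Real.norm_of_nonneg (hγ0 ω)]
    linarith [hγ ω, le_abs_self (Y ω), hC ω]
  have hγLp : MemLp γ 2 Pr :=
    MemLp.of_bound hγm.aestronglyMeasurable _ (Filter.Eventually.of_forall hγb)
  refine ⟨hγLp, ?_, fun ε hε => ?_, ?_, ?_⟩
  · refine (integral_mono (hγLp.integrable one_le_two) ((integrable_const A).add hYi) hγ).trans ?_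
    simp only [Pi.add_apply]
    rw [integral_add (integrable_const A) hYi, hmean]
    simp
  · have h1 := measureReal_ge_le_of_mgf_le hY ⟨C, hC⟩ hm hvar hmgf hε
    have h2 : {ω | ε ≤ Y ω}ᶜ ⊆ {ω | γ ω < A + ε} := fun ω hω => by
      have hω : Y ω < ε := not_le.1 hω
      have := hγ ω
      simp only [Set.mem_ofPred_eq]
      linarith
    have h3 := measureReal_mono (μ := Pr) h2
    rw [probReal_compl_eq_one_sub (measurableSet_le measurable_const hY)] at h3
    linarith
  · have hsq' : Integrable (fun ω => 2 * A * Y ω + Y ω ^ 2) Pr := (hYi.const_mul _).add hY2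
    have hsq : Integrable (fun ω => A ^ 2 + (2 * A * Y ω + Y ω ^ 2)) Pr :=
      (integrable_const _).add hsq'
    refine (variance_le_expectation_sq hγm.aestronglyMeasurable).trans ?_
    refine (integral_mono hγLp.integrable_sq hsq fun ω => ?_).trans ?_
    · have := pow_le_pow_left₀ (hγ0 ω) (hγ ω) 2
      change γ ω ^ 2 ≤ A ^ 2 + (2 * A * Y ω + Y ω ^ 2)
      linarith
    · rw [integral_add (integrable_const _) hsq',
        integral_add (hYi.const_mul _) hY2, integral_const_mul, hmean]
      simpa using hvar
  · refine (integral_mono_of_nonneg (Filter.Eventually.of_forall fun ω => sq_nonneg _) hY2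
      (Filter.Eventually.of_forall fun ω => ?_)).trans hvar
    change max (γ ω - A) 0 ^ 2 ≤ Y ω ^ 2
    rcases le_total (γ ω - A) 0 with h | h
    · rw [max_eq_right h]
      simpa using sq_nonneg (Y ω)
    · rw [max_eq_left h]
      exact pow_le_pow_left₀ h (by linarith [hγ ω]) 2

/-- The accumulated variance of the weighted noise. The term `l = 0` vanishes because the first step
is one. -/
lemma sum_noise_variance_eq_sfwV_div (C₀ : ℝ) (n : ℕ → ℕ) {K N : ℕ} (hK : 1 ≤ K) :
    ∑ l ∈ Finset.range K, (((l : ℝ) + 1) * (l + 2) / (K * (K + 1))) ^ 2 *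
      (2 / ((l : ℝ) + 2) * (1 - 2 / ((l : ℝ) + 2)) * C₀ ^ 2 / (N * n l)) = sfwV C₀ n K / N := by
  have hK0 : (0 : ℝ) < K := by exact_mod_cast hK
  rw [sfwV, Finset.range_eq_Ico, Finset.sum_eq_sum_Ico_succ_bot (by omega), Finset.mul_sum,
    Finset.sum_div]
  simp only [CharP.cast_eq_zero, zero_add]
  norm_num
  refine Finset.sum_congr rfl fun l _ => ?_
  have h : 2 / ((l : ℝ) + 2) * (1 - 2 / ((l : ℝ) + 2)) = 2 * l / ((l : ℝ) + 2) ^ 2 := by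
    field_simp
    ring
  have hl : (l : ℝ) + 2 ≠ 0 := by positivity
  rw [h, div_pow, mul_pow, mul_pow]
  simp only [div_eq_mul_inv, mul_inv]
  have h2 : ((l : ℝ) + 2) ^ 2 * (((l : ℝ) + 2) ^ 2)⁻¹ = 1 := mul_inv_cancel₀ (by positivity)
  linear_combination (2 * C₀ ^ 2 * ((K : ℝ) ^ 2)⁻¹ * (((K : ℝ) + 1) ^ 2)⁻¹ * l * (l + 1) ^ 2 *
    (n l : ℝ)⁻¹ * (N : ℝ)⁻¹) * h2

lemma sfwM_nonneg {C₀ : ℝ} (hC : 0 ≤ C₀) (n : ℕ → ℕ) (K : ℕ) : 0 ≤ sfwM C₀ n K := by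
  refine mul_nonneg (by positivity) (Real.sSup_nonneg ?_)
  rintro _ ⟨k, _, rfl⟩
  positivity

/-- The quantity `m_K / N` bounds the effect of one bit on the weighted noise. -/
lemma weight_mul_le_sfwM_div {C₀ : ℝ} (hC : 0 ≤ C₀) (n : ℕ → ℕ) {K N l : ℕ} (hl : 1 ≤ l)
    (hlK : l < K) :
    ((l : ℝ) + 1) * (l + 2) / (K * (K + 1)) * (C₀ / (N * n l)) ≤ sfwM C₀ n K / N := by
  have hle := le_csSup (((Set.finite_Ico 1 K).image
    (fun k : ℕ => ((k : ℝ) + 1) * ((k : ℝ) + 2) / (n k : ℝ))).bddAbove)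
    ⟨l, ⟨hl, hlK⟩, rfl⟩
  have := mul_le_mul_of_nonneg_left hle (by positivity : 0 ≤ C₀ / ((K : ℝ) * ((K : ℝ) + 1)))
  refine le_trans (le_of_eq ?_) (div_le_div_of_nonneg_right this (Nat.cast_nonneg N))
  simp only [div_eq_mul_inv, mul_inv]
  ring

lemma expNegDiv_mul_div {a v : ℝ} {N : ℝ} (hN : 0 < N) :
    expNegDiv (a * N) v = expNegDiv a (v / N) := by
  unfold expNegDiv
  by_cases hv : v = 0
  · simp [hv]
  · rw [if_neg hv, if_neg (div_ne_zero hv hN.ne')]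
    congr 1
    field_simp

end

theorem theorem3p5 {N M : ℕ} {X : Fin N → Type u} {E : Fin M → Type v}
    [∀ j, NormedAddCommGroup (E j)] [∀ j, InnerProductSpace ℝ (E j)]
    [∀ j, CompleteSpace (E j)] [∀ j, TopologicalSpace.SeparableSpace (E j)]
    (P : AggProblem N M X E) (L Lt : Fin M → ℝ≥0)
    (hreg : P.Regular L Lt) (hconv : P.ConvexCost)
    (S : (i : Fin N) → PiLp 2 E → X i) (hS : P.IsBestResponse S)
    (n : ℕ → ℕ) (hn : ∀ k, 1 ≤ n k) (x0 : ∀ i, X i)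
    {Ω : Type w} [MeasurableSpace Ω] (Pr : Measure Ω) [IsProbabilityMeasure Pr]
    (lam : (k : ℕ) → Fin (n k) → Fin N → Ω → Bool) (x : ℕ → Ω → ∀ i, X i)
    (hx : IsSFW Pr P S (fun k => 2 / ((k : ℝ) + 2)) n x0 lam x)
    (K : ℕ) (hK1 : 1 ≤ K) (hK2 : K ≤ 2 * N)
    (γ : Ω → ℝ) (hγ : γ = fun ω => P.cost (x K ω) - P.relaxedValue) :
    MemLp γ 2 Pr ∧
    ∫ ω, γ ω ∂Pr ≤ 4 * P.C₁ Lt / K ∧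
    (∀ ε : ℝ, 0 < ε →
      1 - expNegDiv (ε ^ 2 * N) (2 * (sfwV (P.C₀ L) n K + ε * sfwM (P.C₀ L) n K / 3)) ≤
        Pr.real {ω | γ ω < 4 * P.C₁ Lt / K + ε}) ∧
    variance γ Pr ≤ 16 * P.C₁ Lt ^ 2 / (K : ℝ) ^ 2 + sfwV (P.C₀ L) n K / N ∧
    ∫ ω, (max (γ ω - 4 * P.C₁ Lt / K) 0) ^ 2 ∂Pr ≤ sfwV (P.C₀ L) n K / N := by
  have hN : (0 : ℝ) < N := by
    have : 0 < N := by omega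
    exact_mod_cast this
  have hK0 : (0 : ℝ) < K := by exact_mod_cast hK1
  have hKK : (0 : ℝ) < K * (K + 1) := by positivity
  have hstep : ∀ k : ℕ, (0 : ℝ) ≤ 2 / ((k : ℝ) + 2) := fun k => by positivity
  have hstep1 : ∀ k : ℕ, 2 / ((k : ℝ) + 2) ≤ 1 := fun k => by
    rw [div_le_one (by positivity)]
    linarith [Nat.cast_nonneg (α := ℝ) k]
  -- The weights `(l + 1) (l + 2)` of the telescoped recursion, normalized at time `K`.
  set a : ℕ → ℝ := fun l => ((l : ℝ) + 1) * (l + 2) / (K * (K + 1)) with ha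
  set Y := IsSFW.mart P S (fun k => 2 / ((k : ℝ) + 2)) n lam x a K with hYdef
  have hC₀ := AggProblem.C₀_nonneg (P := P) (L := L)
  have hC₁ := AggProblem.C₁_nonneg (P := P) (Lt := Lt)
  have hdom : ∀ ω, γ ω ≤ 4 * P.C₁ Lt / K + Y ω := by
    intro ω
    have h := hx.gap_le hreg hconv hS hn ω K hK2
    have hY : Y ω = IsSFW.mart P S (fun k => 2 / ((k : ℝ) + 2)) n lam x
        (fun l => ((l : ℝ) + 1) * (l + 2)) K ω / (K * (K + 1)) := by
      simp only [hYdef, IsSFW.mart, ha, Finset.sum_div]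
      exact Finset.sum_congr rfl fun l _ => by ring
    rw [← le_div_iff₀' hKK, add_div, ← hY] at h
    have h2 : 4 * P.C₁ Lt * K / (K * (K + 1)) ≤ 4 * P.C₁ Lt / K := by
      rw [div_le_div_iff₀ hKK hK0]
      nlinarith [mul_nonneg hC₁ hK0.le]
    rw [hγ]
    change P.cost (x K ω) - P.relaxedValue ≤ _
    linarith
  have hγm : Measurable γ := by
    rw [hγ]
    exact (IsSFW.measurable_comp_past (n := n) (lam := lam) le_rfl
      fun y => P.cost y - P.relaxedValue).mono (hx.sfwPast_le K) le_rfl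
  have hγ0 : ∀ ω, 0 ≤ γ ω := fun ω => by
    rw [hγ]
    exact sub_nonneg.2 (hreg.relaxedValue_le_cost hconv hS _)
  have hvar := hx.integral_mart_sq_le hreg hn hstep hstep1 a K
  rw [sum_noise_variance_eq_sfwV_div (P.C₀ L) n hK1] at hvar
  obtain ⟨h1, h2, h3, h4, h5⟩ := concentration_of_le_add hγm hγ0 hdom (hx.measurable_mart a K)
    (hx.exists_bound_mart a K) (hx.integral_mart hstep a K) hvar
    (div_nonneg (sfwM_nonneg hC₀ n K) hN.le) fun s hs hsm => by
      have := hx.integral_exp_mart_le hreg hn hstep hstep1 (a := a) (fun k => by positivity) hs hsm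
        K fun l hl => by
          rcases Nat.eq_zero_or_pos l with rfl | hl0
          -- The first step is `2 / (0 + 2) = 1`, which explains why `m_K` starts at `k = 1`.
          · left
            norm_num
          · exact Or.inr (weight_mul_le_sfwM_div hC₀ n hl0 hl)
      rwa [sum_noise_variance_eq_sfwV_div (P.C₀ L) n hK1] at this
  refine ⟨h1, h2, fun ε hε => ?_, ?_, h5⟩
  · have := h3 ε hε
    rw [expNegDiv_mul_div hN]
    convert this using 3
    field_simp
  · convert h4 using 2
    ring
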